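/- There are finitely many decision makers (DMs) $t\in\mathcal T=\{1,\dots,T\}$. DM $t$ faces a nonempty finite collection $\mathcal M^t$ of distinct nonempty finite menus. Let $R^t=\{(M,x): M\in\mathcal M^t,\ x\in M\}$. A probabilistic choice rule of DM $t$ is a vector $\rho_t\in\mathbb R^{R^t}_{\ge 0}$ with $\sum_{x\in M}\rho_t(M,x)=1$ for every $M\in\mathcal M^t$. Let $\mathcal C^t$ be a set of allowable choice functions (each picks one element from each menu in $\mathcal M^t$), and let $A^t$ be the $0/1$ matrix with rows indexed by $R^t$ and columns indexed by $\mathcal C^t$, whose entry at $((M,x),c)$ is $1$ if and only if $c(M)=x$. Assume that each $A^t$ is generating: for every probabilistic choice rule $\rho_t$ the system $A^t v=\rho_t$ has a solution $v\in\mathbb R^{\mathcal C^t}$ (entries of any sign). Say that $A^t$ generates a unique representation if this solution is unique for every $\rho_t$. Let $H^t$ be any matrix with finitely many rows such that $\{A^t v: v\ge 0\}=\{z: H^t z\ge 0\}$. A joint probabilistic choice rule is a vector $\rho\in\mathbb R^{\prod_t R^t}_{\ge 0}$ such that, for every menu path $(M_t)_t\in\prod_t\mathcal M^t$, the entries $\rho\big((M_t,x_t)_t\big)$,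 over all $(x_t)_t\in\prod_t M_t$, sum to $1$. A vector $\rho\in\mathbb R^{\prod_t R^t}$ satisfies marginality if, for every DM $t$ and every fixed choice of menus and alternatives of the other DMs, the sum $\sum_{x_t\in M_t}\rho\big((M_s,x_s)_s\big)$ does not depend on $M_t\in\mathcal M^t$. With $\otimes$ the Kronecker product, the experiment produces only separable restrictions if, for every joint probabilistic choice rule $\rho$, $$\Big(\exists\,\nu\ge 0:\ \rho=\big(\textstyle\bigotimes_{t}A^t\big)\nu\Big)\iff\Big(\big(\textstyle\bigotimes_{t}H^t\big)\rho\ge 0\ \text{ and }\rho\text{ satisfies marginality}\Big).$$ Theorem. (i) The experiment produces only separable restrictions if and only if $A^t$ generates a unique representation for all $t\in\mathcal T$ except at most one. (ii) A vector $\rho\in\mathbb R^{\prod_t R^t}$ satisfies marginality if and only if it lies in the linear span of the columns of $\bigotimes_t A^t$. -/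

import Mathlib

namespace SeparableChoice

/-- A nonempty finite collection of distinct nonempty finite menus of alternatives from `X`. -/
structure MenuFamily (X : Type*) where
  menus : Finset (Finset X)
  nonempty : menus.Nonempty
  menu_nonempty : ∀ M ∈ menus, M.Nonempty

/-- The menus of a family, as a type. -/
abbrev Menu {X : Type*} (𝓜 : MenuFamily X) : Type _ := {M : Finset X // M ∈ 𝓜.menus}

/-- The alternatives of a menu. -/
abbrev Alt {X : Type*} {𝓜 : MenuFamily X} (M : Menu 𝓜) : Type _ := {x : X // x ∈ M.1}

/-- The pairs (menu, alternative in that menu): the rows of the individual matrices. -/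
abbrev MenuChoice {X : Type*} (𝓜 : MenuFamily X) : Type _ := Σ M : Menu 𝓜, Alt M

/-- Choice functions: they select one alternative from each menu. -/
abbrev ChoiceFun {X : Type*} (𝓜 : MenuFamily X) : Type _ := ∀ M : Menu 𝓜, Alt M

/-- Individual probabilistic choice rules: a probability distribution on each menu. -/
def IsChoiceRule {X : Type*} {𝓜 : MenuFamily X} (r : MenuChoice 𝓜 → ℝ) : Prop :=
  (∀ a, 0 ≤ r a) ∧ ∀ M : Menu 𝓜, ∑ x : Alt M, r ⟨M, x⟩ = 1

open Classical in
/-- The 0/1 matrix whose columns are the choice functions in the set `𝒞`: the entry at the row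
`(M, x)` and the column `c` is `1` if and only if `c` picks `x` from `M`. -/
noncomputable def choiceMatrix {X : Type*} {𝓜 : MenuFamily X} (𝒞 : Finset (ChoiceFun 𝓜)) :
    Matrix (MenuChoice 𝓜) {c : ChoiceFun 𝓜 // c ∈ 𝒞} ℝ :=
  Matrix.of fun a c => if c.1 a.1 = a.2 then 1 else 0

open scoped Matrix in
/-- Every probabilistic choice rule is a signed combination of the columns. -/
def IsGenerating {X : Type*} {𝓜 : MenuFamily X} (𝒞 : Finset (ChoiceFun 𝓜)) : Prop :=
  ∀ r : MenuChoice 𝓜 → ℝ, IsChoiceRule r → ∃ v, choiceMatrix 𝒞 *ᵥ v = r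

open scoped Matrix in
/-- Every probabilistic choice rule is a signed combination of the columns in exactly one way. -/
def HasUniqueRepresentation {X : Type*} {𝓜 : MenuFamily X} (𝒞 : Finset (ChoiceFun 𝓜)) : Prop :=
  ∀ r : MenuChoice 𝓜 → ℝ, IsChoiceRule r → ∃! v, choiceMatrix 𝒞 *ᵥ v = r

open scoped Matrix in
/-- The inequalities `H z ≥ 0` describe the cone generated by the columns of `A`. -/
def IsHRepresentation {m n r : Type*} [Fintype m] [Fintype n]
    (A : Matrix m n ℝ) (H : Matrix r m ℝ) : Prop :=
  {z | ∃ v, 0 ≤ v ∧ A *ᵥ v = z} = {z | 0 ≤ H *ᵥ z}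

/-- The Kronecker product of a finite family of matrices. -/
def kroneckerFamily {ι : Type*} [Fintype ι] {m n : ι → Type*}
    (B : ∀ t, Matrix (m t) (n t) ℝ) : Matrix (∀ t, m t) (∀ t, n t) ℝ :=
  Matrix.of fun i j => ∏ t, B t (i t) (j t)

/-- Joint probabilistic choice rules: for each menu path `M`, a probability distribution on the
choice paths in `M`. -/
def IsJointChoiceRule {ι : Type*} [Fintype ι] [DecidableEq ι] {X : ι → Type*}
    {𝓜 : ∀ t, MenuFamily (X t)} (ρ : (∀ t, MenuChoice (𝓜 t)) → ℝ) : Prop :=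
  (∀ a, 0 ≤ ρ a) ∧
    ∀ M : ∀ t, Menu (𝓜 t), ∑ x : ∀ t, Alt (M t), ρ (fun t => ⟨M t, x t⟩) = 1

/-- Marginality: for each decision maker `t` and all menus and choices of the others (the values
of `a` off `t`), the sum of `ρ` over the choices of `t` from a menu does not depend on the menu. -/
def Marginality {ι : Type*} [DecidableEq ι] {X : ι → Type*}
    {𝓜 : ∀ t, MenuFamily (X t)} (ρ : (∀ t, MenuChoice (𝓜 t)) → ℝ) : Prop :=
  ∀ (t : ι) (a : ∀ s, MenuChoice (𝓜 s)) (M M' : Menu (𝓜 t)),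
    ∑ x : Alt M, ρ (Function.update a t ⟨M, x⟩) =
      ∑ x : Alt M', ρ (Function.update a t ⟨M', x⟩)

open scoped Matrix in
/-- The generalized experiment produces only separable restrictions: the joint rules generated by
nonnegative weights on profiles of allowable choice functions are exactly those that satisfy the
product restrictions and marginality. -/
def OnlySeparableRestrictions {ι : Type*} [Fintype ι] [DecidableEq ι] {X : ι → Type*}
    {𝓜 : ∀ t, MenuFamily (X t)} (𝒞 : ∀ t, Finset (ChoiceFun (𝓜 t)))
    {R : ι → Type*} (H : ∀ t, Matrix (R t) (MenuChoice (𝓜 t)) ℝ) : Prop :=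
  ∀ ρ : (∀ t, MenuChoice (𝓜 t)) → ℝ, IsJointChoiceRule ρ →
    ((∃ ν, 0 ≤ ν ∧ ρ = kroneckerFamily (fun t => choiceMatrix (𝒞 t)) *ᵥ ν) ↔
      (0 ≤ kroneckerFamily H *ᵥ ρ ∧ Marginality ρ))

end SeparableChoice

open SeparableChoice
open scoped Matrix

/-! Let `K t` be the cone generated by the columns of `choiceMatrix (𝒞 t)`. The joint rules
generated by nonnegative weights form the minimal tensor product of the cones `K t`, generated by
products of columns. Marginality confines `ρ` to the span of these products, and inside that span
the product inequalities cut out the maximal tensor product, on which all products of functionals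
from the dual cones are nonnegative. Part (i) thus asks when the two tensor products coincide. Since
no column lies in the cone of the others, a unique representation means that `K t` is simplicial, so
the answer is: when at most one `K t` is not simplicial.

If all factors but `t₀` are simplicial, the inequalities of a simplicial factor include, up to
positive multiples, its coordinate functionals (`exists_row_eq_single`). Multiplying these together
isolates each slice in direction `t₀`, and each slice is then represented nonnegatively in `K t₀` on
its own (`slice_nonneg`, `exists_nonneg_of_slice_nonneg`).

Conversely, every finitely generated salient cone that is not simplicial has a kite
(`hasKite_of_not_isSimplicialSet`): vectors `a`, `a₁`, `a₂` and `a₁ + a₂ - a` in the cone, and a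
linear map into the cone over a square that sends the first three to three of its edges. Two kites
`a, a₁, a₂` and `b, b₁, b₂` give the tensor `a₁ ⊗ b₂ + a₂ ⊗ b + a ⊗ b₁ - (1/4) a ⊗ b`. All product
functionals are nonnegative on it, but `l₁ ⊗ (k + k₁) + l₂ ⊗ k₂ + l ⊗ (k + k₂)`, which is
nonnegative on products of columns, takes the value `-1/4` (`exists_entangled`).

For part (ii), generation says that each vector with equal menu sums lies in the column space of the
individual matrix. Marginality says that every slice of `ρ` is such a vector, so projecting onto the
column space in each direction in turn leaves `ρ` unchanged. -/

namespace PointedCone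

/-! ### Salient cones, simplicial cones, and how kites pass from quotients and faces to the cone. -/

variable {V : Type*} [AddCommGroup V] [Module ℝ V]

/-- A cone is salient if it contains no line. -/
def NoLine (K : PointedCone ℝ V) : Prop := ∀ x ∈ K, -x ∈ K → x = 0

/-- A set is simplicial if it lies in the cone over one of its linearly independent subsets. -/
def IsSimplicialSet (T : Set V) : Prop :=
  ∃ s ⊆ T, LinearIndepOn ℝ id s ∧ T ⊆ hull ℝ s

/-- The cone contains three vertices `a`, `a₁`, `a₂` of a kite and is mapped into the square cone
`{l₁, l₂, l + l₁, l + l₂ ≥ 0}` in such a way that these become three vertices of the square. -/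
def HasKite (K : PointedCone ℝ V) : Prop :=
  ∃ a ∈ K, ∃ a₁ ∈ K, ∃ a₂ ∈ K, a₁ + a₂ - a ∈ K ∧ ∃ l l₁ l₂ : V →ₗ[ℝ] ℝ,
    (∀ x ∈ K, 0 ≤ l₁ x ∧ 0 ≤ l₂ x ∧ 0 ≤ l x + l₁ x ∧ 0 ≤ l x + l₂ x) ∧
    (l a = 1 ∧ l₁ a = 0 ∧ l₂ a = 0) ∧ (l a₁ = 0 ∧ l₂ a₁ = 0) ∧ (l a₂ = 0 ∧ l₁ a₂ = 0)

lemma nonneg_of_mem_hull {T : Set V} {f : V →ₗ[ℝ] ℝ} (h : ∀ x ∈ T, 0 ≤ f x) :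
    ∀ x ∈ hull ℝ T, 0 ≤ f x := by
  intro x hx
  have : hull ℝ T ≤ (positive ℝ ℝ).comap f := Submodule.span_le.2 fun y hy => h y hy
  exact this hx

lemma map_mem_of_mem_hull {W : Type*} [AddCommGroup W] [Module ℝ W] {T : Set V}
    {K : PointedCone ℝ W} {f : V →ₗ[ℝ] W} (h : ∀ x ∈ T, f x ∈ K) :
    ∀ x ∈ hull ℝ T, f x ∈ K := by
  intro x hx
  have : hull ℝ T ≤ K.comap f := Submodule.span_le.2 fun y hy => h y hy
  exact this hx

lemma exists_preimage_of_mem_hull {W : Type*} [AddCommGroup W] [Module ℝ W] {T : Set V}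
    {f : V →ₗ[ℝ] W} {y : W} (h : y ∈ hull ℝ (f '' T)) : ∃ x ∈ hull ℝ T, f x = y := by
  have : hull ℝ (f '' T) ≤ (hull ℝ T).map f :=
    Submodule.span_le.2 (Set.image_mono subset_hull)
  exact this h

lemma exists_linearMap_eqOn {s : Set V} (hs : LinearIndepOn ℝ id s) (g : V → ℝ) :
    ∃ f : V →ₗ[ℝ] ℝ, ∀ x ∈ s, f x = g x := by
  let b := Module.Basis.extend hs
  refine ⟨b.constr ℝ fun i => g i, fun x hx => ?_⟩
  have := b.constr_basis ℝ (fun i => g i) ⟨x, hs.subset_extend _ hx⟩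
  simpa [b] using this

/-- The functionals are pulled back along `π`. Arbitrary lifts of the vectors satisfy `a₁ + a₂ - a =
e + s • v` with `e` in the cone. Adding `|s| • v` to `a₁` makes the coefficient of `v` nonnegative,
and functionals that factor through `π` do not notice it. -/
lemma HasKite.of_map {T T₁ : Set V} {π : V →ₗ[ℝ] V} {v : V} (hv : v ∈ T) (hπv : π v = 0)
    (hπ : ∀ x, π x = 0 → ∃ s : ℝ, x = s • v) (hT₁ : T₁ = π '' (T \ {v}))
    (h : HasKite (hull ℝ T₁)) : HasKite (hull ℝ T) := by
  have hlift : ∀ y ∈ hull ℝ T₁, ∃ x ∈ hull ℝ T, π x = y := by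
    intro y hy
    rw [hT₁] at hy
    obtain ⟨x, hx, rfl⟩ := exists_preimage_of_mem_hull hy
    exact ⟨x, Submodule.span_mono Set.sdiff_subset hx, rfl⟩
  have hproj : ∀ x ∈ hull ℝ T, π x ∈ hull ℝ T₁ := by
    refine map_mem_of_mem_hull fun x hx => ?_
    by_cases hxv : x = v
    · rw [hxv, hπv]; exact zero_mem _
    · exact subset_hull (hT₁ ▸ ⟨x, ⟨hx, hxv⟩, rfl⟩)
  have hv' : v ∈ hull ℝ T := subset_hull hv
  obtain ⟨a, ha, a₁, ha₁, a₂, ha₂, hsub, l, l₁, l₂, hpos, h0, h1, h2⟩ := h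
  obtain ⟨a, ha', rfl⟩ := hlift a ha
  obtain ⟨a₁, ha₁', rfl⟩ := hlift a₁ ha₁
  obtain ⟨a₂, ha₂', rfl⟩ := hlift a₂ ha₂
  obtain ⟨e, he, hee⟩ := hlift _ hsub
  obtain ⟨s, hs⟩ := hπ (a₁ + a₂ - a - e) (by rw [map_sub, hee]; simp)
  refine ⟨a, ha', a₁ + |s| • v, add_mem ha₁' (smul_mem _ (abs_nonneg s) hv'), a₂, ha₂', ?_,
    l ∘ₗ π, l₁ ∘ₗ π, l₂ ∘ₗ π, fun x hx => hpos _ (hproj x hx), h0, ?_, h2⟩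
  · have : a₁ + |s| • v + a₂ - a = e + (s + |s|) • v := by
      rw [add_smul, ← hs]; abel
    rw [this]
    exact add_mem he (smul_mem _ (by linarith [neg_abs_le s]) hv')
  · simpa [hπv] using h1

/-- The functionals need only be repaired off the face, where `f > 0`. Adding a large multiple `C •
f` to `l₁` and `l₂`, but not to `l`, makes all four combinations nonnegative on the finitely many
generators and changes nothing on the face. -/
lemma HasKite.of_face {T : Set V} (hT : T.Finite) {f : V →ₗ[ℝ] ℝ} (hf : ∀ x ∈ T, 0 ≤ f x)
    (h : HasKite (hull ℝ {x ∈ T | f x = 0})) : HasKite (hull ℝ T) := by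
  have hle : hull ℝ {x ∈ T | f x = 0} ≤ hull ℝ T := Submodule.span_mono fun x hx => hx.1
  have hzero : ∀ x ∈ hull ℝ {x ∈ T | f x = 0}, f x = 0 := fun x hx => le_antisymm
    (by simpa using nonneg_of_mem_hull (f := -f) (fun y hy => by simp [hy.2]) x hx)
    (nonneg_of_mem_hull (fun y hy => hy.2.ge) x hx)
  obtain ⟨a, ha, a₁, ha₁, a₂, ha₂, hsub, l, l₁, l₂, hpos, h0, h1, h2⟩ := h
  have key : ∀ g : V →ₗ[ℝ] ℝ, (∀ x ∈ hull ℝ {x ∈ T | f x = 0}, 0 ≤ g x) →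
      ∀ᶠ C : ℝ in Filter.atTop, ∀ x ∈ hull ℝ T, 0 ≤ (g + C • f) x := by
    intro g hg
    have : ∀ᶠ C : ℝ in Filter.atTop, ∀ x ∈ T, 0 ≤ (g + C • f) x := by
      rw [hT.eventually_all]
      intro x hx
      rcases (hf x hx).eq_or_lt with h | h
      · refine Filter.Eventually.of_forall fun C => ?_
        simpa [← h] using hg x (subset_hull ⟨hx, h.symm⟩)
      · filter_upwards [Filter.eventually_ge_atTop (-g x / f x)] with C hC
        rw [div_le_iff₀ h] at hC
        simp only [LinearMap.add_apply, LinearMap.smul_apply, smul_eq_mul]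
        linarith
    exact this.mono fun C hC => nonneg_of_mem_hull hC
  obtain ⟨C, c1, c2, c3, c4⟩ := ((key l₁ fun x hx => (hpos x hx).1).and
    ((key l₂ fun x hx => (hpos x hx).2.1).and ((key (l + l₁) fun x hx => (hpos x hx).2.2.1).and
      (key (l + l₂) fun x hx => (hpos x hx).2.2.2)))).exists
  refine ⟨a, hle ha, a₁, hle ha₁, a₂, hle ha₂, hle hsub, l, l₁ + C • f, l₂ + C • f,
    fun x hx => ⟨c1 x hx, c2 x hx, ?_, ?_⟩, ?_, ?_, ?_⟩
  · simpa [add_assoc] using c3 x hx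
  · simpa [add_assoc] using c4 x hx
  · simpa [hzero a ha] using h0
  · simpa [hzero a₁ ha₁] using h1
  · simpa [hzero a₂ ha₂] using h2

lemma NoLine.mono {K L : PointedCone ℝ V} (h : NoLine L) (hKL : K ≤ L) : NoLine K :=
  fun x hx hx' => h x (hKL hx) (hKL hx')

/-- A line in the quotient lifts to `y + z = s • v`. For `s ≤ 0` the cone itself would contain `-y`,
so `y = 0`. For `s > 0` the generator `v` would be redundant. -/
lemma NoLine.of_map {T : Set V} {π : V →ₗ[ℝ] V} {v : V} (h : NoLine (hull ℝ T)) (hv : v ∈ T)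
    (hirr : v ∉ hull ℝ (T \ {v})) (hπ : ∀ x, π x = 0 → ∃ s : ℝ, x = s • v) :
    NoLine (hull ℝ (π '' (T \ {v}))) := by
  intro x hx hx'
  obtain ⟨y, hy, rfl⟩ := exists_preimage_of_mem_hull hx
  obtain ⟨z, hz, hzy⟩ := exists_preimage_of_mem_hull hx'
  obtain ⟨s, hs⟩ := hπ (y + z) (by rw [map_add, hzy, add_neg_cancel])
  rcases le_or_gt s 0 with hs0 | hs0
  · have hle : hull ℝ (T \ {v}) ≤ hull ℝ T := Submodule.span_mono Set.sdiff_subset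
    have : y = 0 := by
      refine h y (hle hy) ?_
      have : -y = z + (-s) • v := by rw [neg_smul, ← hs]; abel
      rw [this]
      exact add_mem (hle hz) (smul_mem _ (by linarith) (subset_hull hv))
    rw [this, map_zero]
  · refine absurd ?_ hirr
    have : s⁻¹ • (y + z) = v := by rw [hs, smul_smul, inv_mul_cancel₀ hs0.ne', one_smul]
    have hmem := smul_mem _ (inv_pos.2 hs0).le (add_mem hy hz)
    rwa [this] at hmem

lemma linearIndepOn_of_isSimplicialSet {T : Set V} (h : IsSimplicialSet T)
    (hirr : ∀ v ∈ T, v ∉ hull ℝ (T \ {v})) : LinearIndepOn ℝ id T := by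
  obtain ⟨s, hsT, hs, hTs⟩ := h
  have : s = T := hsT.antisymm fun x hx => by
    by_contra hxs
    have hle : s ⊆ T \ {x} := fun y hy => ⟨hsT hy, fun h => hxs (h ▸ hy)⟩
    exact hirr x hx (Submodule.span_mono hle (hTs hx))
  exact this ▸ hs

end PointedCone

/-! ### Existence of a kite in every non-simplicial salient cone. -/

namespace PointedCone

variable {V : Type*} [AddCommGroup V] [Module ℝ V]

/-- An irredundant cone whose faces and quotients met here are simplicial has a kite,
if it is not simplicial itself. -/
lemma hasKite_of_coordinates [DecidableEq V] {T : Set V} (hT : T.Finite) (hsal : NoLine (hull ℝ T))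
    (hirr : ∀ v ∈ T, v ∉ hull ℝ (T \ {v})) {v x : V} (hv : v ∈ T) (hv0 : v ≠ 0)
    (hx : x ∈ T)
    {B : Finset V} (hBT : ∀ b ∈ B, b ∈ T) (hxB : x ∉ B) (hvB : v ∉ B)
    {l : V → V →ₗ[ℝ] ℝ} {l₀ : V →ₗ[ℝ] ℝ} {t : V → ℝ} {s : ℝ} (hs : s < 0)
    (hxt : x = ∑ b ∈ B, t b • b + s • v) (ht : ∀ b ∈ B, 0 < t b)
    (hl : ∀ b ∈ B, ∀ b' ∈ B, l b b' = if b = b' then 1 else 0) (hlv : ∀ b ∈ B, l b v = 0)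
    (hl₀ : ∀ b ∈ B, l₀ b = 0) (hl₀v : l₀ v = 1) (hlT : ∀ b ∈ B, ∀ y ∈ T, 0 ≤ l b y)
    (hface : ∀ b ∈ B, ∀ y ∈ T, l b y = 0 → 0 ≤ l₀ y) : HasKite (hull ℝ T) := by
  have hvK : v ∈ hull ℝ T := subset_hull hv
  have hxK : x ∈ hull ℝ T := subset_hull hx
  -- With no `b` the relation reads `x = s • v` with `s < 0`, against salience. With a single `b` it
  -- writes `b` as a nonnegative combination of `x` and `v`, against irredundancy.
  obtain ⟨b₁, hb₁, b₂, hb₂, hb⟩ : ∃ b₁ ∈ B, ∃ b₂ ∈ B, b₁ ≠ b₂ := by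
    by_contra! hsub
    rcases B.eq_empty_or_nonempty with rfl | ⟨b, hbB⟩
    · rw [Finset.sum_empty, zero_add] at hxt
      have : s • v = 0 := hxt ▸ hsal x hxK (by
        rw [hxt, ← neg_smul]; exact smul_mem _ (by linarith) hvK)
      rcases smul_eq_zero.1 this with h | h
      · exact hs.ne h
      · exact hv0 h
    · have hB : B = {b} := Finset.eq_singleton_iff_unique_mem.2 ⟨hbB, fun c hc => hsub c hc b hbB⟩
      rw [hB, Finset.sum_singleton] at hxt
      have htb := ht b hbB
      have : (t b)⁻¹ • (x + (-s) • v) = b := by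
        rw [hxt, neg_smul, add_neg_cancel_right, smul_smul, inv_mul_cancel₀ htb.ne', one_smul]
      have hmem : (t b)⁻¹ • (x + (-s) • v) ∈ hull ℝ (T \ {b}) := by
        refine smul_mem _ (inv_pos.2 htb).le (add_mem (subset_hull ⟨hx, ?_⟩)
          (smul_mem _ (by linarith) (subset_hull ⟨hv, ?_⟩)))
        · rintro rfl; exact hxB hbB
        · rintro rfl; exact hvB hbB
      rw [this] at hmem
      exact hirr b (hBT b hbB) hmem
  have hsum : ∀ (f : V →ₗ[ℝ] ℝ) (D : Finset V), f (∑ b ∈ D, t b • b) = ∑ b ∈ D, t b * f b :=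
    fun f D => by simp [map_sum]
  have hmem : ∀ D ⊆ B, ∑ b ∈ D, t b • b ∈ hull ℝ T := fun D hD =>
    sum_mem fun b hb => smul_mem _ (ht b (hD hb)).le (subset_hull (hBT b (hD hb)))
  -- On the face `l c = 0` the functional `l₀` is already nonnegative, so a large multiple of `l c`
  -- corrects it at the other generators.
  have key : ∀ c ∈ B, ∀ᶠ C : ℝ in Filter.atTop, ∀ y ∈ T, 0 ≤ (l₀ + C • l c) y := by
    intro c hc
    rw [hT.eventually_all]
    intro y hy
    rcases (hlT c hc y hy).eq_or_lt with h | h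
    · refine Filter.Eventually.of_forall fun C => ?_
      simpa [← h] using hface c hc y hy h.symm
    · filter_upwards [Filter.eventually_ge_atTop (-l₀ y / l c y)] with C hC
      rw [div_le_iff₀ h] at hC
      simp only [LinearMap.add_apply, LinearMap.smul_apply, smul_eq_mul]
      linarith
  obtain ⟨C, hC0, hC1, hC2⟩ := ((Filter.eventually_ge_atTop 0).and
    ((key b₁ hb₁).and (key b₂ hb₂))).exists
  have hs' : 0 < (-s)⁻¹ := inv_pos.2 (by linarith)
  -- The relation rewritten as `v + (-s)⁻¹ • x = (-s)⁻¹ • ∑ t b • b` is the kite: `v` and a multiple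
  -- of `x` are opposite vertices, and the right side is split into the `b₂` term and the rest.
  refine ⟨v, hvK, (-s)⁻¹ • ∑ b ∈ B.erase b₂, t b • b,
    smul_mem _ hs'.le (hmem _ (Finset.erase_subset _ _)), (-s)⁻¹ • ∑ b ∈ {b₂}, t b • b,
    smul_mem _ hs'.le (hmem _ (by simpa using hb₂)), ?_, l₀, C • l b₁, C • l b₂,
    fun y hy => ⟨?_, ?_, ?_, ?_⟩, ⟨hl₀v, ?_, ?_⟩, ⟨?_, ?_⟩, ⟨?_, ?_⟩⟩
  · have : (-s)⁻¹ • ∑ b ∈ B.erase b₂, t b • b + (-s)⁻¹ • ∑ b ∈ {b₂}, t b • b - v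
        = (-s)⁻¹ • x := by
      rw [hxt, ← smul_add, Finset.sum_singleton, Finset.sum_erase_add _ _ hb₂, smul_add, smul_smul]
      have : (-s)⁻¹ * s = -1 := by
        rw [inv_neg, neg_mul, inv_mul_cancel₀ hs.ne]
      rw [this, neg_one_smul, sub_eq_add_neg]
    rw [this]
    exact smul_mem _ hs'.le hxK
  · exact mul_nonneg hC0 (nonneg_of_mem_hull (hlT b₁ hb₁) y hy)
  · exact mul_nonneg hC0 (nonneg_of_mem_hull (hlT b₂ hb₂) y hy)
  · exact nonneg_of_mem_hull hC1 y hy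
  · exact nonneg_of_mem_hull hC2 y hy
  · simp [hlv b₁ hb₁]
  · simp [hlv b₂ hb₂]
  · rw [map_smul, hsum, Finset.sum_eq_zero, smul_zero]
    intro b hb
    rw [hl₀ b (Finset.mem_of_mem_erase hb), mul_zero]
  · rw [map_smul, hsum, Finset.sum_eq_zero, smul_zero]
    intro b hb
    rw [LinearMap.smul_apply, hl b₂ hb₂ b (Finset.mem_of_mem_erase hb),
      if_neg (Finset.ne_of_mem_erase hb).symm, smul_zero, mul_zero]
  · simp [hl₀ b₂ hb₂]
  · simp [hl b₁ hb₁ b₂ hb₂, hb]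

/-- Induction on the number of generators. Redundant generators are dropped. If the quotient by some
generator `v`, or a face given by a coordinate of a simplicial quotient, is not simplicial, it has a
kite that can be transferred. Otherwise a generator outside `v` and the lifted basis has a negative
`v`-coordinate and positive other coordinates, and this single relation is a kite. -/
theorem hasKite_of_not_isSimplicialSet {T : Set V} (hT : T.Finite) (hsal : NoLine (hull ℝ T))
    (hns : ¬ IsSimplicialSet T) : HasKite (hull ℝ T) := by
  classical
  induction hn : T.ncard using Nat.strong_induction_on generalizing T with
  | _ n ih =>
  by_cases hirr : ∃ v ∈ T, v ∈ hull ℝ (T \ {v})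
  · obtain ⟨v, hv, hvK⟩ := hirr
    have hle : hull ℝ T ≤ hull ℝ (T \ {v}) := Submodule.span_le.2 fun x hx => by
      by_cases hxv : x = v
      · rwa [hxv]
      · exact subset_hull ⟨hx, hxv⟩
    have heq : hull ℝ (T \ {v}) = hull ℝ T :=
      le_antisymm (Submodule.span_mono Set.sdiff_subset) hle
    rw [← heq]
    refine ih _ ?_ (hT.subset Set.sdiff_subset) (heq ▸ hsal) ?_ rfl
    · rw [← hn]; exact Set.ncard_sdiff_singleton_lt_of_mem hv hT
    · rintro ⟨s, hsT, hs, hTs⟩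
      refine hns ⟨s, hsT.trans Set.sdiff_subset, hs, fun x hx => ?_⟩
      exact Submodule.span_le.2 hTs (hle (subset_hull hx))
  push Not at hirr
  obtain ⟨v, hv⟩ : T.Nonempty := by
    by_contra h
    rw [Set.not_nonempty_iff_eq_empty] at h
    exact hns ⟨∅, Set.empty_subset _, linearIndepOn_empty _ _, by simp [h]⟩
  have hv0 : v ≠ 0 := by
    rintro rfl
    exact hirr 0 hv (zero_mem _)
  obtain ⟨φ, hφ⟩ := Module.Projective.exists_dual_eq_one ℝ hv0
  let π : V →ₗ[ℝ] V := LinearMap.id - φ.smulRight v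
  have hπdef : ∀ x, π x = x - φ x • v := fun x => rfl
  have hπv : π v = 0 := by rw [hπdef, hφ, one_smul, sub_self]
  have hπ : ∀ x, π x = 0 → ∃ s : ℝ, x = s • v := fun x hx => ⟨φ x, by
    rw [hπdef, sub_eq_zero] at hx; exact hx⟩
  by_cases hquot : IsSimplicialSet (π '' (T \ {v}))
  swap
  · refine HasKite.of_map hv hπv hπ rfl (ih _ ?_ ((hT.subset Set.sdiff_subset).image _)
      (hsal.of_map hv (hirr v hv) hπ) hquot rfl)
    rw [← hn]
    exact (Set.ncard_image_le (hT.subset Set.sdiff_subset)).trans_lt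
      (Set.ncard_sdiff_singleton_lt_of_mem hv hT)
  obtain ⟨s₁, hs₁, hind, hgen⟩ := hquot
  obtain ⟨B, hBT, hinj, rfl⟩ := Set.SurjOn.exists_subset_injOn_image_eq hs₁
  have hBind : LinearIndepOn ℝ π B := (linearIndepOn_iff_image hinj).2 hind
  -- `B` lifts a basis of the simplicial quotient, so its span meets the kernel of `π` only in `0`,
  -- and `v` lies in that kernel.
  have hE : LinearIndepOn ℝ id (insert v B) := by
    refine LinearIndepOn.id_insert (LinearIndependent.of_comp π hBind) fun hvs => hv0 ?_
    have := Submodule.range_ker_disjoint (f := π) (v := ((↑) : B → V)) hBind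
    rw [Subtype.range_coe] at this
    exact Submodule.disjoint_def.1 this v hvs hπv
  have hdec : ∀ x ∈ T, ∃ y ∈ hull ℝ B, ∃ s : ℝ, x = y + s • v := by
    intro x hx
    by_cases hxv : x = v
    · exact ⟨0, zero_mem _, 1, by simp [hxv]⟩
    · obtain ⟨y, hy, hyx⟩ := exists_preimage_of_mem_hull (hgen ⟨x, ⟨hx, hxv⟩, rfl⟩)
      obtain ⟨s, hs⟩ := hπ (x - y) (by rw [map_sub, hyx, sub_self])
      exact ⟨y, hy, s, by rw [← hs]; abel⟩
  have hvB : v ∉ B := fun h => (hBT h).2 rfl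
  have hBfin : B.Finite := hT.subset (hBT.trans Set.sdiff_subset)
  lift B to Finset V using hBfin
  choose l hl using fun b : V => exists_linearMap_eqOn hE (fun x => if b = x then 1 else 0)
  have hlv : ∀ b ∈ B, l b v = 0 := fun b hb => by
    rw [hl b v (Set.mem_insert _ _), if_neg]
    rintro rfl; exact hvB hb
  have hlB : ∀ b, ∀ b' ∈ B, l b b' = if b = b' then 1 else 0 :=
    fun b b' hb' => hl b b' (Set.mem_insert_of_mem _ hb')
  have hl0 : ∀ b ∈ B, l v b = 0 := fun b hb => by
    rw [hlB v b hb, if_neg]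
    rintro rfl; exact hvB hb
  have hexp : ∀ y ∈ hull ℝ (B : Set V), y = ∑ b ∈ B, l b y • b := by
    intro y hy
    have : Set.EqOn (LinearMap.id : V →ₗ[ℝ] V) ((∑ b ∈ B, (l b).smulRight b : V →ₗ[ℝ] V)) B := by
      intro x hx
      have hx' : x ∈ B := hx
      simp [LinearMap.sum_apply, hlB _ x hx', hx']
    simpa [LinearMap.sum_apply] using LinearMap.eqOn_span this (hull_le_span ℝ _ hy)
  have hlhull : ∀ b ∈ B, ∀ y ∈ hull ℝ (B : Set V), 0 ≤ l b y := fun b _ =>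
    nonneg_of_mem_hull fun x hx => by rw [hlB b x hx]; split_ifs <;> norm_num
  have hlT : ∀ b ∈ B, ∀ x ∈ T, 0 ≤ l b x := by
    intro b hb x hx
    obtain ⟨y, hy, s, rfl⟩ := hdec x hx
    simpa [hlv b hb] using hlhull b hb y hy
  by_cases hfaces : ∃ b ∈ B, ¬ IsSimplicialSet {x ∈ T | l b x = 0}
  · obtain ⟨b, hb, hnsb⟩ := hfaces
    have hss : {x ∈ T | l b x = 0} ⊂ T := by
      refine ⟨Set.sep_subset _ _, fun h => ?_⟩
      have := (h (hBT hb).1).2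
      rw [hlB b b hb, if_pos rfl] at this
      exact one_ne_zero this
    refine HasKite.of_face hT (hlT b hb) (ih _ ?_ (hT.subset hss.1)
      (hsal.mono (Submodule.span_mono hss.1)) hnsb rfl)
    rw [← hn]
    exact Set.ncard_lt_ncard hss hT
  push Not at hfaces
  have hl₀B : ∀ y ∈ hull ℝ (B : Set V), l v y = 0 := fun y hy => by
    rw [hexp y hy, map_sum]
    exact Finset.sum_eq_zero fun b hb => by rw [map_smul, hl0 b hb, smul_zero]
  have hlvv : l v v = 1 := by rw [hl v v (Set.mem_insert _ _), if_pos rfl]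
  -- The face is simplicial and irredundant, hence linearly independent. A generator on it other
  -- than `v` and the members of `B` would lie in the span of `v` and those members of `B` that are
  -- on the face.
  have hface : ∀ b ∈ B, ∀ x ∈ T, l b x = 0 → 0 ≤ l v x := by
    intro b hb x hx hbx
    have hind : LinearIndepOn ℝ id {x ∈ T | l b x = 0} := by
      refine linearIndepOn_of_isSimplicialSet (hfaces b hb) fun w hw hmem => ?_
      have hle : {x ∈ T | l b x = 0} \ {w} ⊆ T \ {w} := Set.sdiff_subset_sdiff_left fun y hy => hy.1
      exact hirr w hw.1 (Submodule.span_mono hle hmem)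
    by_cases hxv : x = v
    · rw [hxv, hlvv]; exact zero_le_one
    by_cases hxB : x ∈ B
    · rw [hl0 x hxB]
    exfalso
    obtain ⟨y, hy, s, rfl⟩ := hdec x hx
    have hyb : l b y = 0 := by simpa [hlv b hb] using hbx
    refine hind.notMem_span ⟨hx, hbx⟩ ?_
    rw [Set.image_id]
    refine add_mem ?_ (Submodule.smul_mem _ _ (Submodule.subset_span ⟨⟨hv, hlv b hb⟩, Ne.symm hxv⟩))
    suffices h : ∑ c ∈ B, l c y • c ∈ Submodule.span ℝ ({x ∈ T | l b x = 0} \ {y + s • v}) by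
      rwa [← hexp y hy] at h
    refine sum_mem fun c hc => ?_
    by_cases hcb : c = b
    · rw [hcb, hyb, zero_smul]; exact zero_mem _
    · refine Submodule.smul_mem _ _ (Submodule.subset_span ⟨⟨(hBT hc).1, ?_⟩, ?_⟩)
      · rw [hlB b c hc, if_neg (Ne.symm hcb)]
      · rintro rfl; exact hxB hc
  obtain ⟨x, hx, hxvB⟩ : ∃ x ∈ T, x ∉ insert v (B : Set V) := by
    by_contra! hsub
    exact hns ⟨T, subset_rfl, hE.mono hsub, subset_hull⟩
  have hxv : x ≠ v := fun h => hxvB (h ▸ Set.mem_insert _ _)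
  have hxB : x ∉ B := fun h => hxvB (Set.mem_insert_of_mem _ h)
  obtain ⟨y, hy, s, hxys⟩ := hdec x hx
  -- Were `s ≥ 0`, then `x` would be a nonnegative combination of `v` and `B`, hence redundant.
  have hs : s < 0 := by
    by_contra! hs
    refine hirr x hx ?_
    have hle : (B : Set V) ⊆ T \ {x} := fun b hb => ⟨(hBT hb).1, fun h => hxB (h ▸ hb)⟩
    have := add_mem (Submodule.span_mono hle hy)
      (smul_mem (hull ℝ (T \ {x})) hs (subset_hull ⟨hv, Ne.symm hxv⟩))
    rwa [← hxys] at this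
  have hlx : ∀ b ∈ B, l b x = l b y := fun b hb => by simp [hxys, hlv b hb]
  refine hasKite_of_coordinates hT hsal hirr hv hv0 hx (fun b hb => (hBT hb).1) hxB hvB
    hs (t := fun b => l b y) (by rw [← hexp y hy]; exact hxys) (fun b hb => ?_)
    (fun b _ b' hb' => hlB b b' hb') hlv hl0 hlvv hlT hface
  -- A vanishing coordinate would put `x` on a face where `l v` is nonnegative, but `l v x = s < 0`.
  refine (hlhull b hb y hy).lt_of_ne' fun h => ?_
  have := hface b hb x hx ((hlx b hb).trans h)
  rw [hxys, map_add, hl₀B y hy, map_smul, hlvv] at this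
  simp only [smul_eq_mul, mul_one, zero_add] at this
  exact absurd this (not_le.2 hs)

end PointedCone

namespace SeparableChoice

open scoped Matrix

/-! ### Kronecker products of finite families. -/

section Kronecker

variable {ι : Type*} [Fintype ι] {l m n : ι → Type*}

/-- The elementary tensor of a finite family of vectors. -/
def pureTensor (x : ∀ t, m t → ℝ) : (∀ t, m t) → ℝ := fun i => ∏ t, x t (i t)

lemma sum_prod_eq_prod_sum [DecidableEq ι] [∀ t, Fintype (m t)] (f : ∀ t, m t → ℝ) :
    ∑ i : ∀ t, m t, ∏ t, f t (i t) = ∏ t, ∑ j, f t j :=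
  (Fintype.prod_sum f).symm

lemma pureTensor_dotProduct [DecidableEq ι] [∀ t, Fintype (m t)] (f x : ∀ t, m t → ℝ) :
    pureTensor f ⬝ᵥ pureTensor x = ∏ t, f t ⬝ᵥ x t := by
  simp only [dotProduct, pureTensor, ← Finset.prod_mul_distrib]
  exact sum_prod_eq_prod_sum fun t j => f t j * x t j

lemma kroneckerFamily_mulVec_pureTensor [DecidableEq ι] [∀ t, Fintype (n t)]
    (B : ∀ t, Matrix (m t) (n t) ℝ) (x : ∀ t, n t → ℝ) :
    kroneckerFamily B *ᵥ pureTensor x = pureTensor fun t => B t *ᵥ x t :=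
  funext fun i => pureTensor_dotProduct (fun t => B t (i t)) x

lemma kroneckerFamily_mul [DecidableEq ι] [∀ t, Fintype (m t)]
    (A : ∀ t, Matrix (l t) (m t) ℝ) (B : ∀ t, Matrix (m t) (n t) ℝ) :
    kroneckerFamily A * kroneckerFamily B = kroneckerFamily fun t => A t * B t := by
  ext i k
  exact pureTensor_dotProduct (fun t => A t (i t)) fun t j => B t j (k t)

lemma kroneckerFamily_one [∀ t, DecidableEq (m t)] [DecidableEq (∀ t, m t)] :
    kroneckerFamily (fun t => (1 : Matrix (m t) (m t) ℝ)) = 1 := by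
  ext i j
  simp only [kroneckerFamily, Matrix.of_apply, Matrix.one_apply]
  rw [Finset.prod_ite_zero]
  simp [funext_iff]

lemma kroneckerFamily_nonneg {B : ∀ t, Matrix (m t) (n t) ℝ} (h : ∀ t i j, 0 ≤ B t i j) (i j) :
    0 ≤ kroneckerFamily B i j :=
  Finset.prod_nonneg fun t _ => h t (i t) (j t)

lemma mulVec_nonneg_of_nonneg {p q : Type*} [Fintype q] {B : Matrix p q ℝ}
    (hB : ∀ i j, 0 ≤ B i j) {v : q → ℝ} (hv : 0 ≤ v) : 0 ≤ B *ᵥ v :=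
  fun i => Finset.sum_nonneg fun j _ => mul_nonneg (hB i j) (hv j)

/-- The identity factors kill every index that differs from `a` off `t`, so only one slice
contributes. -/
lemma kroneckerFamily_single_mulVec [DecidableEq ι] [∀ t, Fintype (m t)]
    [∀ t, DecidableEq (m t)] (t : ι)
    (P : Matrix (m t) (m t) ℝ) (ρ : (∀ t, m t) → ℝ) (a : ∀ t, m t) :
    (kroneckerFamily (Function.update (fun s => (1 : Matrix (m s) (m s) ℝ)) t P) *ᵥ ρ) a =
      (P *ᵥ fun j => ρ (Function.update a t j)) (a t) := by
  symm
  refine Fintype.sum_of_injective (Function.update a t) (Function.update_injective a t) _ _ ?_ ?_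
  · intro b hb
    obtain ⟨s, hs, hsb⟩ : ∃ s, s ≠ t ∧ a s ≠ b s := by
      by_contra! h
      refine hb ⟨b t, funext fun s => ?_⟩
      by_cases hst : s = t
      · subst hst; simp
      · simp [hst, h s hst]
    have : kroneckerFamily (Function.update (fun s => (1 : Matrix (m s) (m s) ℝ)) t P) a b = 0 := by
      refine Finset.prod_eq_zero (Finset.mem_univ s) ?_
      rw [Function.update_of_ne hs, Matrix.one_apply_ne hsb]
    exact mul_eq_zero_of_left this _
  · intro j
    have : kroneckerFamily (Function.update (fun s => (1 : Matrix (m s) (m s) ℝ)) t P) a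
        (Function.update a t j) = P (a t) j := by
      refine (Finset.prod_eq_single t ?_ (by simp)).trans (by simp)
      intro s _ hs
      simp [hs]
    exact congrArg (· * ρ (Function.update a t j)) this.symm

/-- A tensor all of whose slices are fixed by the matrices `P t` is fixed by their
Kronecker product. -/
lemma kroneckerFamily_mulVec_eq_self [DecidableEq ι] [∀ t, Fintype (m t)]
    (P : ∀ t, Matrix (m t) (m t) ℝ) (ρ : (∀ t, m t) → ℝ)
    (h : ∀ t (a : ∀ t, m t), (P t *ᵥ fun j => ρ (Function.update a t j)) =
      fun j => ρ (Function.update a t j)) :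
    kroneckerFamily P *ᵥ ρ = ρ := by
  classical
  -- The identity factors are replaced by `P t` one at a time; each replacement acts on slices in a
  -- single direction.
  suffices H : ∀ S : Finset ι, kroneckerFamily (fun t => if t ∈ S then P t else 1) *ᵥ ρ = ρ by
    simpa using H Finset.univ
  intro S
  induction S using Finset.induction_on with
  | empty => simp [kroneckerFamily_one]
  | insert t S ht ih =>
    have : (fun s => if s ∈ insert t S then P s else 1) = fun s =>
        Function.update (fun s => (1 : Matrix (m s) (m s) ℝ)) t (P t) s *
          (if s ∈ S then P s else 1) := by
      funext s
      by_cases hst : s = t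
      · subst hst; simp [ht]
      · simp [hst]
    rw [this, ← kroneckerFamily_mul, ← Matrix.mulVec_mulVec, ih]
    funext a
    rw [kroneckerFamily_single_mulVec, h]
    simp

end Kronecker

/-! ### The individual matrices: column space and uniqueness. -/

section Individual

variable {X : Type*} {𝓜 : MenuFamily X}

instance (M : Menu 𝓜) : Nonempty (Alt M) := (𝓜.menu_nonempty M.1 M.2).to_subtype

instance : Nonempty (Menu 𝓜) := 𝓜.nonempty.to_subtype

lemma choiceMatrix_nonneg (𝒞 : Finset (ChoiceFun 𝓜)) (a c) : 0 ≤ choiceMatrix 𝒞 a c := by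
  simp only [choiceMatrix, Matrix.of_apply]
  split_ifs <;> norm_num

lemma sum_choiceMatrix (𝒞 : Finset (ChoiceFun 𝓜)) (M : Menu 𝓜) (c) :
    ∑ x : Alt M, choiceMatrix 𝒞 ⟨M, x⟩ c = 1 := by
  classical
  simp only [choiceMatrix, Matrix.of_apply]
  rw [Finset.sum_eq_single (c.1 M)]
  · simp
  · intro x _ hx
    exact if_neg (Ne.symm hx)
  · simp

/-- The uniform choice rule. -/
noncomputable def uniformRule (𝓜 : MenuFamily X) : MenuChoice 𝓜 → ℝ :=
  fun a => (Fintype.card (Alt a.1) : ℝ)⁻¹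

lemma uniformRule_pos (a : MenuChoice 𝓜) : 0 < uniformRule 𝓜 a := by
  have : 0 < Fintype.card (Alt a.1) := Fintype.card_pos
  exact inv_pos.2 (by exact_mod_cast this)

lemma isChoiceRule_uniformRule : IsChoiceRule (uniformRule 𝓜) := by
  refine ⟨fun a => (uniformRule_pos a).le, fun M => ?_⟩
  have : (Fintype.card (Alt M) : ℝ) ≠ 0 := by exact_mod_cast Fintype.card_ne_zero
  change ∑ _x : Alt M, (Fintype.card (Alt M) : ℝ)⁻¹ = 1
  rw [Finset.sum_const, Finset.card_univ, nsmul_eq_mul]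
  exact mul_inv_cancel₀ this

/-- A vector whose sums over the menus coincide is a signed combination of the columns. -/
lemma exists_mulVec_eq_of_sum_eq {𝒞 : Finset (ChoiceFun 𝓜)} (hgen : IsGenerating 𝒞)
    (z : MenuChoice 𝓜 → ℝ)
    (hz : ∀ M M' : Menu 𝓜, ∑ x : Alt M, z ⟨M, x⟩ = ∑ x : Alt M', z ⟨M', x⟩) :
    ∃ v, choiceMatrix 𝒞 *ᵥ v = z := by
  obtain ⟨M₀⟩ : Nonempty (Menu 𝓜) := inferInstance
  set k := ∑ x : Alt M₀, z ⟨M₀, x⟩ with hk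
  -- Adding a large multiple of the strictly positive uniform rule makes `z` nonnegative with
  -- positive menu sum `k + C`; after scaling it is a choice rule.
  obtain ⟨C, hC, hpos⟩ : ∃ C : ℝ, 0 < k + C ∧ ∀ a, 0 ≤ z a + C * uniformRule 𝓜 a := by
    refine ((Filter.eventually_gt_atTop (-k)).and (Filter.eventually_all.2 fun a =>
      Filter.eventually_ge_atTop (-z a / uniformRule 𝓜 a))).exists.imp fun C hC => ⟨?_, ?_⟩
    · linarith [hC.1]
    · intro a
      have := hC.2 a
      rw [div_le_iff₀ (uniformRule_pos a)] at this
      linarith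
  obtain ⟨u, hu⟩ := hgen _ isChoiceRule_uniformRule
  obtain ⟨w, hw⟩ := hgen (fun a => (k + C)⁻¹ * (z a + C * uniformRule 𝓜 a))
    ⟨fun a => mul_nonneg (inv_pos.2 hC).le (hpos a), fun M => by
      rw [← Finset.mul_sum, Finset.sum_add_distrib, ← Finset.mul_sum, hz M M₀, ← hk,
        isChoiceRule_uniformRule.2 M, mul_one, inv_mul_cancel₀ hC.ne']⟩
  refine ⟨(k + C) • w - C • u, ?_⟩
  rw [Matrix.mulVec_sub, Matrix.mulVec_smul, Matrix.mulVec_smul, hu, hw]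
  funext a
  simp only [Pi.sub_apply, Pi.smul_apply, smul_eq_mul]
  rw [mul_inv_cancel_left₀ hC.ne', add_sub_cancel_right]

/-- A generalized inverse: `A * Q` fixes the column space of `A`. As a matrix it can enter Kronecker
products. -/
lemma exists_rightInverse_on_range {p q : Type*} [Fintype p] [Fintype q] (A : Matrix p q ℝ) :
    ∃ Q : Matrix q p ℝ, ∀ v, (A * Q) *ᵥ (A *ᵥ v) = A *ᵥ v := by
  classical
  obtain ⟨g, hg⟩ := A.mulVecLin.rangeRestrict.exists_rightInverse_of_surjective
    (LinearMap.range_rangeRestrict _)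
  obtain ⟨h, hh⟩ := g.exists_extend
  refine ⟨LinearMap.toMatrix' h, fun v => ?_⟩
  have h1 : h (A *ᵥ v) = g ⟨A *ᵥ v, v, rfl⟩ := LinearMap.congr_fun hh ⟨A *ᵥ v, v, rfl⟩
  have h2 := congrArg Subtype.val (LinearMap.congr_fun hg ⟨A *ᵥ v, v, rfl⟩)
  rw [← Matrix.mulVec_mulVec, LinearMap.toMatrix'_mulVec, h1]
  exact h2

/-- A kernel vector can be added to a representation of the uniform rule, so uniqueness for this one
rule already forces injectivity. -/
lemma hasUniqueRepresentation_iff {𝒞 : Finset (ChoiceFun 𝓜)} (hgen : IsGenerating 𝒞) :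
    HasUniqueRepresentation 𝒞 ↔ Function.Injective (choiceMatrix 𝒞).mulVec := by
  constructor
  · intro h v w hvw
    obtain ⟨u, hu, huniq⟩ := h _ isChoiceRule_uniformRule
    have : u + (v - w) = u := huniq _ (by
      dsimp only
      rw [Matrix.mulVec_add, Matrix.mulVec_sub, hvw, sub_self, add_zero, hu])
    exact sub_eq_zero.1 (by simpa using this)
  · intro h r hr
    obtain ⟨v, hv⟩ := hgen r hr
    exact ⟨v, hv, fun w hw => h (hw.trans hv.symm)⟩

end Individual

/-! ### Marginality is membership in the column space. -/

section Joint

variable {ι : Type*} [Fintype ι] [DecidableEq ι] {X : ι → Type*} {𝓜 : ∀ t, MenuFamily (X t)}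

/-- Every column of an individual matrix sums to `1` over each menu, so summing out `t` removes its
factor whatever the menu is. -/
theorem marginality_kroneckerFamily_mulVec (𝒞 : ∀ t, Finset (ChoiceFun (𝓜 t))) (v) :
    Marginality (kroneckerFamily (fun t => choiceMatrix (𝒞 t)) *ᵥ v) := by
  intro t a M M'
  have key : ∀ M : Menu (𝓜 t), ∑ x : Alt M,
      (kroneckerFamily (fun t => choiceMatrix (𝒞 t)) *ᵥ v) (Function.update a t ⟨M, x⟩) =
        ∑ c, (∏ s ∈ Finset.univ.erase t, choiceMatrix (𝒞 s) (a s) (c s)) * v c := by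
    intro M
    simp only [Matrix.mulVec, dotProduct]
    rw [Finset.sum_comm]
    refine Finset.sum_congr rfl fun c _ => ?_
    rw [← Finset.sum_mul]
    congr 1
    rw [← one_mul (∏ s ∈ Finset.univ.erase t, _), ← sum_choiceMatrix (𝒞 t) M (c t),
      Finset.sum_mul]
    refine Finset.sum_congr rfl fun x _ => ?_
    rw [kroneckerFamily, Matrix.of_apply, ← Finset.mul_prod_erase _ _ (Finset.mem_univ t),
      Function.update_self]
    congr 1
    refine Finset.prod_congr rfl fun s hs => ?_
    rw [Function.update_of_ne (Finset.ne_of_mem_erase hs)]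
  rw [key, key]

/-- Each slice of `ρ` has equal menu sums, hence is fixed by the matrix `A * Q` of its direction; so
`ρ` is fixed by the Kronecker product of these matrices, which factors through that of the choice
matrices. -/
theorem exists_eq_kroneckerFamily_mulVec_of_marginality {𝒞 : ∀ t, Finset (ChoiceFun (𝓜 t))}
    (hgen : ∀ t, IsGenerating (𝒞 t)) {ρ : (∀ t, MenuChoice (𝓜 t)) → ℝ} (hρ : Marginality ρ) :
    ∃ v, ρ = kroneckerFamily (fun t => choiceMatrix (𝒞 t)) *ᵥ v := by
  choose Q hQ using fun t => exists_rightInverse_on_range (choiceMatrix (𝒞 t))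
  refine ⟨kroneckerFamily Q *ᵥ ρ, ?_⟩
  rw [Matrix.mulVec_mulVec, kroneckerFamily_mul]
  refine (kroneckerFamily_mulVec_eq_self _ ρ fun t a => ?_).symm
  obtain ⟨v, hv⟩ := exists_mulVec_eq_of_sum_eq (hgen t)
    (fun j => ρ (Function.update a t j)) (hρ t a)
  rw [← hv, hQ]

end Joint

end SeparableChoice

/-! ### Sufficiency: at most one cone is not simplicial. -/

namespace SeparableChoice

open scoped Matrix

/-- If a matrix is nonnegative only on nonnegative vectors, then some of its rows are positive
multiples of the unit vectors. -/
lemma exists_row_eq_single {r n : Type*} [Finite r] [Fintype n] {G : Matrix r n ℝ}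
    (hG : ∀ i j, 0 ≤ G i j) (h : ∀ v, 0 ≤ G *ᵥ v → 0 ≤ v) (c : n) :
    ∃ i, 0 < G i c ∧ ∀ j, j ≠ c → G i j = 0 := by
  classical
  by_contra! hcon
  have key : ∀ i, ∀ᶠ ε : ℝ in nhdsWithin 0 (Set.Ioi 0),
      0 ≤ ∑ j ∈ Finset.univ.erase c, G i j - ε * G i c := by
    intro i
    rcases (hG i c).eq_or_lt with hi | hi
    · refine Filter.Eventually.of_forall fun ε => ?_
      rw [← hi, mul_zero, sub_zero]
      exact Finset.sum_nonneg fun j _ => hG i j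
    · obtain ⟨j, hjc, hj⟩ := hcon i hi
      have hpos : 0 < ∑ j ∈ Finset.univ.erase c, G i j :=
        Finset.sum_pos' (fun j _ => hG i j) ⟨j, by simp [hjc], (hG i j).lt_of_ne' hj⟩
      filter_upwards [Ioo_mem_nhdsGT (div_pos hpos hi)] with ε hε
      have := hε.2
      rw [lt_div_iff₀ hi] at this
      linarith
  obtain ⟨ε, hε, hpos⟩ := ((Filter.eventually_all.2 key).and self_mem_nhdsWithin).exists
  -- If every row positive at `c` has another positive entry, the vector with `-ε` at `c` and `1`
  -- elsewhere is mapped to a nonnegative vector for small `ε`, although it is not nonnegative.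
  have := h (fun j => if j = c then -ε else 1) (fun i => by
    have hi := hε i
    simp only [Matrix.mulVec, dotProduct, Pi.zero_apply]
    rw [← Finset.add_sum_erase _ _ (Finset.mem_univ c), if_pos rfl]
    have : ∑ j ∈ Finset.univ.erase c, G i j * (if j = c then -ε else 1) =
        ∑ j ∈ Finset.univ.erase c, G i j :=
      Finset.sum_congr rfl fun j hj => by rw [if_neg (Finset.ne_of_mem_erase hj), mul_one]
    rw [this]
    linarith) c
  simp only [Pi.zero_apply, if_pos] at this
  have hpos' : 0 < ε := hpos
  linarith

/-- Summing over all slices counts each index once for every element of `n t`; the involution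
exchanging the coordinate `c t` with the free variable `j` shows this. -/
lemma sum_eq_zero_of_sum_update_eq_zero {ι : Type*} [Fintype ι] [DecidableEq ι] {n : ι → Type*}
    [∀ t, Fintype (n t)] (t : ι) (f : (∀ t, n t) → ℝ)
    (h : ∀ c, ∑ j, f (Function.update c t j) = 0) : ∑ c, f c = 0 := by
  rcases isEmpty_or_nonempty (n t) with he | hne
  · have : IsEmpty (∀ t, n t) := ⟨fun c => he.elim (c t)⟩
    simp
  have hinv : Function.Involutive fun p : (∀ t, n t) × n t =>
      (Function.update p.1 t p.2, p.1 t) := fun p => by simp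
  have h1 : ∑ p : (∀ t, n t) × n t, f (Function.update p.1 t p.2) =
      ∑ p : (∀ t, n t) × n t, f p.1 :=
    Fintype.sum_equiv hinv.toPerm _ _ fun p => rfl
  rw [Fintype.sum_prod_type, Fintype.sum_prod_type, Finset.sum_congr rfl fun c _ => h c] at h1
  simp only [Finset.sum_const_zero, Finset.sum_const, Finset.card_univ, nsmul_eq_mul,
    ← Finset.mul_sum] at h1
  have hcard : (Fintype.card (n t) : ℝ) ≠ 0 := by exact_mod_cast Fintype.card_ne_zero
  exact (mul_eq_zero.1 h1.symm).resolve_left hcard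

section Individual

variable {X : Type*} {𝓜 : MenuFamily X} {𝒞 : Finset (ChoiceFun 𝓜)} {R : Type*}
  {H : Matrix R (MenuChoice 𝓜) ℝ}

lemma IsHRepresentation.nonneg_iff (hH : IsHRepresentation (choiceMatrix 𝒞) H) (z) :
    0 ≤ H *ᵥ z ↔ ∃ v, 0 ≤ v ∧ choiceMatrix 𝒞 *ᵥ v = z := (Set.ext_iff.1 hH z).symm

lemma IsHRepresentation.mul_nonneg (hH : IsHRepresentation (choiceMatrix 𝒞) H) (i c) :
    0 ≤ (H * choiceMatrix 𝒞) i c := by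
  classical
  have := (hH.nonneg_iff _).2 ⟨Pi.single c 1, Pi.single_nonneg.2 zero_le_one, rfl⟩ i
  rwa [Matrix.mulVec_mulVec, Matrix.mulVec_single_one] at this

lemma IsHRepresentation.exists_row (hgen : IsGenerating 𝒞) (hu : HasUniqueRepresentation 𝒞)
    [Finite R] (hH : IsHRepresentation (choiceMatrix 𝒞) H) (c) :
    ∃ i, 0 < (H * choiceMatrix 𝒞) i c ∧ ∀ j, j ≠ c → (H * choiceMatrix 𝒞) i j = 0 := by
  refine exists_row_eq_single hH.mul_nonneg (fun v hv => ?_) c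
  rw [← Matrix.mulVec_mulVec, hH.nonneg_iff] at hv
  obtain ⟨w, hw, hwv⟩ := hv
  exact (hasUniqueRepresentation_iff hgen).1 hu hwv ▸ hw

end Individual

variable {ι : Type*} [Fintype ι] [DecidableEq ι] {X : ι → Type*} {𝓜 : ∀ t, MenuFamily (X t)}
  {𝒞 : ∀ t, Finset (ChoiceFun (𝓜 t))} {R : ι → Type*}
  {H : ∀ t, Matrix (R t) (MenuChoice (𝓜 t)) ℝ}

/-- For `t ≠ t₀` uniqueness supplies a row of `H t * choiceMatrix (𝒞 t)` supported at `c t` alone.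
The product of these rows with row `i` at `t₀` reads off, up to a positive factor, the `i`-th
inequality on the slice through `c`. -/
lemma slice_nonneg [∀ t, Finite (R t)] (hgen : ∀ t, IsGenerating (𝒞 t))
    (hH : ∀ t, IsHRepresentation (choiceMatrix (𝒞 t)) (H t)) {t₀ : ι}
    (hu : ∀ t, t ≠ t₀ → HasUniqueRepresentation (𝒞 t)) (v)
    (hv : 0 ≤ kroneckerFamily (fun t => H t * choiceMatrix (𝒞 t)) *ᵥ v) (c) :
    0 ≤ (H t₀ * choiceMatrix (𝒞 t₀)) *ᵥ fun j => v (Function.update c t₀ j) := by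
  intro i
  have hrow : ∀ t, ∃ r, t ≠ t₀ → 0 < (H t * choiceMatrix (𝒞 t)) r (c t) ∧
      ∀ j, j ≠ c t → (H t * choiceMatrix (𝒞 t)) r j = 0 := by
    intro t
    by_cases ht : t = t₀
    · subst ht; exact ⟨i, fun h => absurd rfl h⟩
    · obtain ⟨r, hr⟩ := (hH t).exists_row (hgen t) (hu t ht) (c t)
      exact ⟨r, fun _ => hr⟩
  choose r hr using hrow
  set G := fun t => H t * choiceMatrix (𝒞 t) with hG
  set K := ∏ t ∈ Finset.univ.erase t₀, G t (r t) (c t) with hK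
  have hKpos : 0 < K := Finset.prod_pos fun t ht => (hr t (Finset.ne_of_mem_erase ht)).1
  have key : (kroneckerFamily G *ᵥ v) (Function.update r t₀ i) =
      K * (G t₀ *ᵥ fun j => v (Function.update c t₀ j)) i := by
    simp only [Matrix.mulVec, dotProduct, Finset.mul_sum]
    symm
    refine Fintype.sum_of_injective (Function.update c t₀) (Function.update_injective c t₀)
      _ _ ?_ ?_
    · intro b hb
      obtain ⟨s, hs, hsb⟩ : ∃ s, s ≠ t₀ ∧ b s ≠ c s := by
        by_contra! h
        refine hb ⟨b t₀, funext fun s => ?_⟩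
        by_cases hst : s = t₀
        · subst hst; simp
        · simp [hst, h s hst]
      refine mul_eq_zero_of_left (Finset.prod_eq_zero (Finset.mem_univ s) ?_) _
      rw [Function.update_of_ne hs]
      exact (hr s hs).2 _ hsb
    · intro j
      rw [kroneckerFamily, Matrix.of_apply, ← Finset.mul_prod_erase _ _ (Finset.mem_univ t₀),
        Function.update_self, Function.update_self]
      have : ∏ t ∈ Finset.univ.erase t₀,
          G t (Function.update r t₀ i t) (Function.update c t₀ j t) = K :=
        Finset.prod_congr rfl fun t ht => by
          rw [Function.update_of_ne (Finset.ne_of_mem_erase ht),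
            Function.update_of_ne (Finset.ne_of_mem_erase ht)]
      rw [this]
      ring
  have := hv (Function.update r t₀ i)
  rw [key] at this
  exact nonneg_of_mul_nonneg_right this hKpos

/-- Each slice of `v` in direction `t₀` is replaced by a nonnegative vector with the same image
under the matrix of `t₀`. The replacement is chosen as a function of the slice, so the pieces fit
together. -/
lemma exists_nonneg_of_slice_nonneg {t₀ : ι}
    (hH : IsHRepresentation (choiceMatrix (𝒞 t₀)) (H t₀)) (v : (∀ t, {c // c ∈ 𝒞 t}) → ℝ)
    (hv : ∀ c, 0 ≤ (H t₀ * choiceMatrix (𝒞 t₀)) *ᵥ fun j => v (Function.update c t₀ j)) :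
    ∃ ν, 0 ≤ ν ∧ kroneckerFamily (fun t => choiceMatrix (𝒞 t)) *ᵥ v =
      kroneckerFamily (fun t => choiceMatrix (𝒞 t)) *ᵥ ν := by
  have hex : ∀ u, ∃ w, 0 ≤ (H t₀ * choiceMatrix (𝒞 t₀)) *ᵥ u →
      0 ≤ w ∧ choiceMatrix (𝒞 t₀) *ᵥ w = choiceMatrix (𝒞 t₀) *ᵥ u := by
    intro u
    by_cases hu : 0 ≤ (H t₀ * choiceMatrix (𝒞 t₀)) *ᵥ u
    · obtain ⟨w, hw⟩ := (hH.nonneg_iff (choiceMatrix (𝒞 t₀) *ᵥ u)).1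
        (by rwa [Matrix.mulVec_mulVec])
      exact ⟨w, fun _ => hw⟩
    · exact ⟨0, fun h => absurd h hu⟩
  choose w hw using hex
  refine ⟨fun c => w (fun j => v (Function.update c t₀ j)) (c t₀), fun c => (hw _ (hv c)).1 _, ?_⟩
  rw [← sub_eq_zero, ← Matrix.mulVec_sub]
  funext i
  refine sum_eq_zero_of_sum_update_eq_zero t₀ _ fun c => ?_
  have hc := congrFun (hw _ (hv c)).2 (i t₀)
  rw [eq_comm, ← sub_eq_zero, ← Pi.sub_apply, ← Matrix.mulVec_sub] at hc
  have : ∀ j, kroneckerFamily (fun t => choiceMatrix (𝒞 t)) i (Function.update c t₀ j) =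
      (∏ t ∈ Finset.univ.erase t₀, choiceMatrix (𝒞 t) (i t) (c t)) *
        choiceMatrix (𝒞 t₀) (i t₀) j := by
    intro j
    rw [kroneckerFamily, Matrix.of_apply, ← Finset.prod_erase_mul _ _ (Finset.mem_univ t₀),
      Function.update_self]
    congr 1
    exact Finset.prod_congr rfl fun t ht => by
      rw [Function.update_of_ne (Finset.ne_of_mem_erase ht)]
  simp only [this, Pi.sub_apply, Function.update_idem, Function.update_self, mul_assoc,
    ← Finset.mul_sum]
  exact mul_eq_zero_of_right _ hc

theorem product_restrictions_of_nonneg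
    (hH : ∀ t, IsHRepresentation (choiceMatrix (𝒞 t)) (H t)) {ν} (hν : 0 ≤ ν) :
    0 ≤ kroneckerFamily H *ᵥ (kroneckerFamily (fun t => choiceMatrix (𝒞 t)) *ᵥ ν) := by
  rw [Matrix.mulVec_mulVec, kroneckerFamily_mul]
  exact mulVec_nonneg_of_nonneg (kroneckerFamily_nonneg fun t => (hH t).mul_nonneg) hν

theorem onlySeparableRestrictions_of_subsingleton [∀ t, Finite (R t)]
    (hgen : ∀ t, IsGenerating (𝒞 t))
    (hH : ∀ t, IsHRepresentation (choiceMatrix (𝒞 t)) (H t))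
    (h : {t | ¬ HasUniqueRepresentation (𝒞 t)}.Subsingleton) :
    OnlySeparableRestrictions 𝒞 H := by
  refine fun ρ hρ => ⟨?_, fun ⟨hHρ, hm⟩ => ?_⟩
  · rintro ⟨ν, hν, rfl⟩
    exact ⟨product_restrictions_of_nonneg hH hν, marginality_kroneckerFamily_mulVec 𝒞 ν⟩
  obtain ⟨v, rfl⟩ := exists_eq_kroneckerFamily_mulVec_of_marginality hgen hm
  rcases isEmpty_or_nonempty ι with hι | hι
  -- Without decision makers the Kronecker product is the `1 × 1` matrix `1`, so `v` is `ρ` itself.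
  · refine ⟨v, fun c => ?_, rfl⟩
    simpa [Matrix.mulVec, dotProduct, kroneckerFamily, Subsingleton.elim default c]
      using hρ.1 isEmptyElim
  · obtain ⟨t₀, ht₀⟩ : ∃ t₀, ∀ t, t ≠ t₀ → HasUniqueRepresentation (𝒞 t) := by
      by_cases hex : ∃ t₀, ¬ HasUniqueRepresentation (𝒞 t₀)
      · obtain ⟨t₀, ht₀⟩ := hex
        refine ⟨t₀, fun t ht => ?_⟩
        by_contra hu
        exact ht (h hu ht₀)
      · push Not at hex
        exact ⟨Classical.arbitrary ι, fun t _ => hex t⟩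
    rw [Matrix.mulVec_mulVec, kroneckerFamily_mul] at hHρ
    exact exists_nonneg_of_slice_nonneg (hH t₀) v (slice_nonneg hgen hH ht₀ v hHρ)

end SeparableChoice

/-! ### Necessity: two kites yield a non-separable joint rule. -/

namespace SeparableChoice

open scoped Matrix
open PointedCone

section Individual

variable {X : Type*} {𝓜 : MenuFamily X} (𝒞 : Finset (ChoiceFun 𝓜))

lemma choiceMatrix_col_injective : Function.Injective (choiceMatrix 𝒞).col := by
  classical
  intro c d h
  refine Subtype.ext (funext fun M => ?_)
  have := congrFun h ⟨M, c.1 M⟩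
  simp only [choiceMatrix, Matrix.col_apply, Matrix.of_apply, if_true] at this
  by_contra hcd
  rw [if_neg (Ne.symm hcd)] at this
  exact one_ne_zero this

lemma noLine_hull_choiceMatrix_col : NoLine (hull ℝ (Set.range (choiceMatrix 𝒞).col)) := by
  have hle : hull ℝ (Set.range (choiceMatrix 𝒞).col) ≤ positive ℝ (MenuChoice 𝓜 → ℝ) := by
    refine Submodule.span_le.2 ?_
    rintro _ ⟨c, rfl⟩
    exact fun a => choiceMatrix_nonneg 𝒞 a c
  intro x hx hx'
  have h1 : 0 ≤ x := hle hx
  have h2 : 0 ≤ -x := hle hx'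
  exact le_antisymm (neg_nonneg.1 h2) h1

/-- The columns generate distinct extreme rays. -/
lemma choiceMatrix_col_notMem_hull (c : {c // c ∈ 𝒞}) :
    (choiceMatrix 𝒞).col c ∉
      hull ℝ (Set.range (choiceMatrix 𝒞).col \ {(choiceMatrix 𝒞).col c}) := by
  classical
  -- `f` adds the entries at all pairs that `c` does not choose: it vanishes at the column of `c`
  -- and is positive at every other column.
  let f : (MenuChoice 𝓜 → ℝ) →ₗ[ℝ] ℝ :=
    ∑ a : MenuChoice 𝓜, if c.1 a.1 = a.2 then 0 else LinearMap.proj a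
  have hf : ∀ z, f z = ∑ a : MenuChoice 𝓜, if c.1 a.1 = a.2 then 0 else z a := by
    intro z
    simp only [f, LinearMap.sum_apply]
    refine Finset.sum_congr rfl fun a _ => ?_
    split_ifs <;> simp
  have hpos : ∀ d, d ≠ c → 0 < f ((choiceMatrix 𝒞).col d) := by
    intro d hd
    obtain ⟨M, hM⟩ : ∃ M, d.1 M ≠ c.1 M := by
      by_contra! h
      exact hd (Subtype.ext (funext h))
    rw [hf]
    refine Finset.sum_pos' (fun a _ => ?_) ⟨⟨M, d.1 M⟩, Finset.mem_univ _, ?_⟩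
    · split_ifs
      · exact le_rfl
      · exact choiceMatrix_nonneg 𝒞 a d
    · rw [if_neg (Ne.symm hM)]
      simp [choiceMatrix]
  have hc : f ((choiceMatrix 𝒞).col c) = 0 := by
    rw [hf]
    refine Finset.sum_eq_zero fun a _ => ?_
    split_ifs with h
    · rfl
    · simp [choiceMatrix, h]
  have key : ∀ x ∈ hull ℝ (Set.range (choiceMatrix 𝒞).col \ {(choiceMatrix 𝒞).col c}),
      x = 0 ∨ 0 < f x := by
    intro x hx
    induction hx using Submodule.span_induction with
    | mem x hx =>
      obtain ⟨⟨d, rfl⟩, hd⟩ := hx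
      exact Or.inr (hpos d fun h => hd (h ▸ rfl))
    | zero => exact Or.inl rfl
    | add x y _ _ hx hy =>
      rcases hx with rfl | hx
      · simpa using hy
      · rcases hy with rfl | hy
        · simpa using Or.inr hx
        · exact Or.inr (by rw [map_add]; exact add_pos hx hy)
    | smul r x _ hx =>
      rcases hx with rfl | hx
      · exact Or.inl (smul_zero _)
      · rcases r.2.eq_or_lt with hr | hr
        · have : r = 0 := Subtype.ext hr.symm
          exact Or.inl (by rw [this, zero_smul])
        · refine Or.inr ?_
          have : f (r • x) = r.1 * f x := map_smul f r.1 x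
          rw [this]
          exact mul_pos hr hx
  intro hmem
  rcases key _ hmem with h | h
  · obtain ⟨M⟩ : Nonempty (Menu 𝓜) := inferInstance
    have := congrFun h ⟨M, c.1 M⟩
    simp [choiceMatrix] at this
  · exact h.ne' hc

variable {𝒞}

lemma not_isSimplicialSet_choiceMatrix_col (hgen : IsGenerating 𝒞)
    (hu : ¬ HasUniqueRepresentation 𝒞) :
    ¬ IsSimplicialSet (Set.range (choiceMatrix 𝒞).col) := by
  intro h
  refine hu ((hasUniqueRepresentation_iff hgen).2 ?_)
  have hind := linearIndepOn_of_isSimplicialSet h (by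
    rintro _ ⟨c, rfl⟩
    exact choiceMatrix_col_notMem_hull 𝒞 c)
  rw [Matrix.mulVec_injective_iff]
  exact (linearIndepOn_id_range_iff (choiceMatrix_col_injective 𝒞)).1 hind

lemma exists_mulVec_eq_of_mem_hull {x : MenuChoice 𝓜 → ℝ}
    (hx : x ∈ hull ℝ (Set.range (choiceMatrix 𝒞).col)) : ∃ u, choiceMatrix 𝒞 *ᵥ u = x := by
  have : Set.range (choiceMatrix 𝒞).col ⊆ (choiceMatrix 𝒞).mulVecLin.range := by
    classical
    rintro _ ⟨c, rfl⟩
    exact ⟨Pi.single c 1, Matrix.mulVec_single_one _ _⟩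
  exact Submodule.span_le.2 this (hull_le_span ℝ _ hx)

lemma exists_dotProduct_eq {m : Type*} [Fintype m] (f : (m → ℝ) →ₗ[ℝ] ℝ) :
    ∃ p : m → ℝ, ∀ x, f x = p ⬝ᵥ x := by
  classical
  refine ⟨fun i => f (Pi.single i 1), fun x => ?_⟩
  rw [LinearMap.pi_apply_eq_sum_univ f x]
  simp only [dotProduct, smul_eq_mul]
  exact Finset.sum_congr rfl fun i _ => by
    rw [mul_comm]; congr 2; funext j; simp [Pi.single_apply, eq_comm]

/-- The kite of a cone with non-unique representations, with all functionals as vectors. -/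
lemma exists_kite (hgen : IsGenerating 𝒞) (hu : ¬ HasUniqueRepresentation 𝒞) :
    ∃ u u₁ u₂ : {c // c ∈ 𝒞} → ℝ, ∃ l l₁ l₂ : MenuChoice 𝓜 → ℝ,
      (∀ p, (∀ c, 0 ≤ p ⬝ᵥ (choiceMatrix 𝒞).col c) →
        0 ≤ p ⬝ᵥ (choiceMatrix 𝒞 *ᵥ u) ∧ 0 ≤ p ⬝ᵥ (choiceMatrix 𝒞 *ᵥ u₁) ∧
        0 ≤ p ⬝ᵥ (choiceMatrix 𝒞 *ᵥ u₂) ∧ p ⬝ᵥ (choiceMatrix 𝒞 *ᵥ u) ≤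
          p ⬝ᵥ (choiceMatrix 𝒞 *ᵥ u₁) + p ⬝ᵥ (choiceMatrix 𝒞 *ᵥ u₂)) ∧
      (∀ c, 0 ≤ l₁ ⬝ᵥ (choiceMatrix 𝒞).col c ∧ 0 ≤ l₂ ⬝ᵥ (choiceMatrix 𝒞).col c ∧
        0 ≤ l ⬝ᵥ (choiceMatrix 𝒞).col c + l₁ ⬝ᵥ (choiceMatrix 𝒞).col c ∧
        0 ≤ l ⬝ᵥ (choiceMatrix 𝒞).col c + l₂ ⬝ᵥ (choiceMatrix 𝒞).col c) ∧
      (l ⬝ᵥ (choiceMatrix 𝒞 *ᵥ u) = 1 ∧ l₁ ⬝ᵥ (choiceMatrix 𝒞 *ᵥ u) = 0 ∧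
        l₂ ⬝ᵥ (choiceMatrix 𝒞 *ᵥ u) = 0) ∧
      (l ⬝ᵥ (choiceMatrix 𝒞 *ᵥ u₁) = 0 ∧ l₂ ⬝ᵥ (choiceMatrix 𝒞 *ᵥ u₁) = 0) ∧
      (l ⬝ᵥ (choiceMatrix 𝒞 *ᵥ u₂) = 0 ∧ l₁ ⬝ᵥ (choiceMatrix 𝒞 *ᵥ u₂) = 0) := by
  obtain ⟨a, ha, a₁, ha₁, a₂, ha₂, hsub, l, l₁, l₂, hpos, h0, h1, h2⟩ :=
    hasKite_of_not_isSimplicialSet (Set.finite_range _) (noLine_hull_choiceMatrix_col 𝒞)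
      (not_isSimplicialSet_choiceMatrix_col hgen hu)
  have hp : ∀ p : MenuChoice 𝓜 → ℝ, (∀ c, 0 ≤ p ⬝ᵥ (choiceMatrix 𝒞).col c) →
      ∀ x ∈ hull ℝ (Set.range (choiceMatrix 𝒞).col), 0 ≤ p ⬝ᵥ x := by
    intro p hp
    refine nonneg_of_mem_hull (f := dotProductBilin ℝ ℝ p) ?_
    rintro _ ⟨c, rfl⟩
    exact hp c
  obtain ⟨u, rfl⟩ := exists_mulVec_eq_of_mem_hull ha
  obtain ⟨u₁, rfl⟩ := exists_mulVec_eq_of_mem_hull ha₁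
  obtain ⟨u₂, rfl⟩ := exists_mulVec_eq_of_mem_hull ha₂
  obtain ⟨q, hq⟩ := exists_dotProduct_eq l
  obtain ⟨q₁, hq₁⟩ := exists_dotProduct_eq l₁
  obtain ⟨q₂, hq₂⟩ := exists_dotProduct_eq l₂
  simp only [hq, hq₁, hq₂] at hpos h0 h1 h2
  refine ⟨u, u₁, u₂, q, q₁, q₂, fun p h => ⟨hp p h _ ha, hp p h _ ha₁, hp p h _ ha₂, ?_⟩,
    fun c => hpos _ (subset_hull ⟨c, rfl⟩), h0, h1, h2⟩
  have := hp p h _ hsub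
  rw [dotProduct_sub, dotProduct_add] at this
  linarith

end Individual

/-! ### Products with two distinguished factors, and the scalar inequalities for two kites. -/

section TwoFactors

variable {ι : Type*} [DecidableEq ι]

/-- A family with two of its members replaced. -/
def update₂ {α : ι → Type*} (z : ∀ t, α t) (t₁ : ι) (y₁ : α t₁) (t₂ : ι) (y₂ : α t₂) :
    ∀ t, α t :=
  Function.update (Function.update z t₁ y₁) t₂ y₂

lemma prod_update₂ [Fintype ι] {α β : ι → Type*} (G : ∀ t, α t → β t → ℝ) {t₁ t₂ : ι}
    (h : t₁ ≠ t₂) (p : ∀ t, α t) (x₁ : α t₁) (x₂ : α t₂) (z : ∀ t, β t) (y₁ : β t₁) (y₂ : β t₂) :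
    ∏ t, G t (update₂ p t₁ x₁ t₂ x₂ t) (update₂ z t₁ y₁ t₂ y₂ t) =
      (∏ t ∈ (Finset.univ.erase t₁).erase t₂, G t (p t) (z t)) * (G t₁ x₁ y₁ * G t₂ x₂ y₂) := by
  rw [← Finset.prod_erase_mul _ _ (Finset.mem_univ t₁),
    ← Finset.prod_erase_mul (Finset.univ.erase t₁) _ (Finset.mem_erase.2 ⟨h.symm, Finset.mem_univ t₂⟩),
    mul_assoc]
  congr 1
  · refine Finset.prod_congr rfl fun t ht => ?_
    have h2 := Finset.ne_of_mem_erase ht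
    have h1 := Finset.ne_of_mem_erase (Finset.mem_of_mem_erase ht)
    simp [update₂, h1, h2]
  · simp [update₂, h, mul_comm]

lemma prod_update₂_right [Fintype ι] {α β : ι → Type*} (G : ∀ t, α t → β t → ℝ) {t₁ t₂ : ι}
    (h : t₁ ≠ t₂) (p : ∀ t, α t) (z : ∀ t, β t) (y₁ : β t₁) (y₂ : β t₂) :
    ∏ t, G t (p t) (update₂ z t₁ y₁ t₂ y₂ t) =
      (∏ t ∈ (Finset.univ.erase t₁).erase t₂, G t (p t) (z t)) *
        (G t₁ (p t₁) y₁ * G t₂ (p t₂) y₂) := by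
  rw [← prod_update₂ G h]
  simp [update₂]

lemma prod_update₂_left [Fintype ι] {α β : ι → Type*} (G : ∀ t, α t → β t → ℝ) {t₁ t₂ : ι}
    (h : t₁ ≠ t₂) (p : ∀ t, α t) (x₁ : α t₁) (x₂ : α t₂) (z : ∀ t, β t) :
    ∏ t, G t (update₂ p t₁ x₁ t₂ x₂ t) (z t) =
      (∏ t ∈ (Finset.univ.erase t₁).erase t₂, G t (p t) (z t)) *
        (G t₁ x₁ (z t₁) * G t₂ x₂ (z t₂)) :=
  prod_update₂_right (fun t y x => G t x y) h z p x₁ x₂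

end TwoFactors

/-- The product functionals are nonnegative on the tensor built from two kites. -/
lemma kite_product_nonneg {p p₁ p₂ q q₁ q₂ : ℝ} (hp : 0 ≤ p) (hp₁ : 0 ≤ p₁) (hp₂ : 0 ≤ p₂)
    (hq : 0 ≤ q) (hq₁ : 0 ≤ q₁) (hq₂ : 0 ≤ q₂) (h : p ≤ p₁ + p₂) (h' : q ≤ q₁ + q₂) :
    0 ≤ p₁ * q₂ + p₂ * q + p * q₁ - 1 / 4 * (p * q) := by
  have e1 := mul_nonneg hp₁ hq₂
  have e2 := mul_nonneg hp₂ hq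
  have e3 := mul_nonneg hp hq₁
  have e4 := mul_nonneg hp hq
  -- If `p₂ ≥ p / 2` or `q₁ ≥ q / 2`, a single term is at least `p * q / 2`. Otherwise `p₁ ≥ p / 2`
  -- and `q₂ ≥ q / 2` give `p₁ * q₂ ≥ p * q / 4`, which is where the constant comes from.
  rcases le_total (p / 2) p₂ with h2 | h2
  · nlinarith [mul_le_mul_of_nonneg_right h2 hq]
  rcases le_total (q / 2) q₁ with h1 | h1
  · nlinarith [mul_le_mul_of_nonneg_left h1 hp]
  have h3 : p / 2 ≤ p₁ := by linarith
  have h4 : q / 2 ≤ q₂ := by linarith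
  nlinarith [mul_le_mul h3 h4 (by linarith) hp₁]

/-- The witness is nonnegative on the products of two columns. -/
lemma kite_witness_nonneg {l l₁ l₂ k k₁ k₂ : ℝ} (h₁ : 0 ≤ l₁) (h₂ : 0 ≤ l₂) (h₃ : 0 ≤ l + l₁)
    (h₄ : 0 ≤ l + l₂) (g₁ : 0 ≤ k₁) (g₂ : 0 ≤ k₂) (g₃ : 0 ≤ k + k₁) (g₄ : 0 ≤ k + k₂) :
    0 ≤ l₁ * (k + k₁) + l₂ * k₂ + l * (k + k₂) := by
  -- For `l₁ ≤ l₂` the expression equals `l₁ * k₁ + (l₂ - l₁) * k₂ + (l + l₁) * (k + k₂)`; otherwise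
  -- it equals `l₂ * k₁ + (l₁ - l₂) * (k + k₁) + (l + l₂) * (k + k₂)`.
  rcases le_total l₁ l₂ with h | h
  · nlinarith [mul_nonneg h₁ g₁, mul_nonneg (sub_nonneg.2 h) g₂, mul_nonneg h₃ g₄]
  · nlinarith [mul_nonneg h₂ g₁, mul_nonneg (sub_nonneg.2 h) g₃, mul_nonneg h₄ g₄]

/-! ### The entangled tensor and the two directions combined. -/

section Joint

variable {ι : Type*} [Fintype ι] [DecidableEq ι] {X : ι → Type*} {𝓜 : ∀ t, MenuFamily (X t)}
  {𝒞 : ∀ t, Finset (ChoiceFun (𝓜 t))} {R : ι → Type*}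
  {H : ∀ t, Matrix (R t) (MenuChoice (𝓜 t)) ℝ}

lemma sum_kroneckerFamily_mulVec (v) (M : ∀ t, Menu (𝓜 t)) :
    ∑ x : ∀ t, Alt (M t),
      (kroneckerFamily (fun t => choiceMatrix (𝒞 t)) *ᵥ v) (fun t => ⟨M t, x t⟩) = ∑ c, v c := by
  simp only [Matrix.mulVec, dotProduct]
  rw [Finset.sum_comm]
  refine Finset.sum_congr rfl fun c _ => ?_
  rw [← Finset.sum_mul]
  have := sum_prod_eq_prod_sum fun t (x : Alt (M t)) => choiceMatrix (𝒞 t) ⟨M t, x⟩ (c t)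
  simp only [sum_choiceMatrix, Finset.prod_const_one] at this
  simp only [kroneckerFamily, Matrix.of_apply]
  rw [this, one_mul]

/-- The witness of non-separability: a tensor `ρ = (⨂ Aᵗ) v` that satisfies all product
restrictions, and a functional that is nonnegative on the columns and negative at `ρ`. -/
lemma exists_entangled (hgen : ∀ t, IsGenerating (𝒞 t)) {t₁ t₂ : ι} (hne : t₁ ≠ t₂)
    (h₁ : ¬ HasUniqueRepresentation (𝒞 t₁)) (h₂ : ¬ HasUniqueRepresentation (𝒞 t₂)) :
    ∃ v, (∀ p : ∀ t, MenuChoice (𝓜 t) → ℝ, (∀ t c, 0 ≤ p t ⬝ᵥ (choiceMatrix (𝒞 t)).col c) →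
        0 ≤ pureTensor p ⬝ᵥ (kroneckerFamily (fun t => choiceMatrix (𝒞 t)) *ᵥ v)) ∧
      ∃ W, (∀ c, 0 ≤ W ⬝ᵥ (kroneckerFamily (fun t => choiceMatrix (𝒞 t))).col c) ∧
        W ⬝ᵥ (kroneckerFamily (fun t => choiceMatrix (𝒞 t)) *ᵥ v) < 0 := by
  classical
  obtain ⟨u, u₁, u₂, l, l₁, l₂, hu, hl, h0, h1, h2⟩ := exists_kite (hgen t₁) h₁
  obtain ⟨w, w₁, w₂, k, k₁, k₂, hw, hk, g0, g1, g2⟩ := exists_kite (hgen t₂) h₂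
  have hC : ∀ t, Nonempty {c // c ∈ 𝒞 t} := by
    intro t
    by_contra hemp
    rw [not_nonempty_iff] at hemp
    obtain ⟨r, hr⟩ := hgen t _ isChoiceRule_uniformRule
    obtain ⟨M⟩ : Nonempty (Menu (𝓜 t)) := inferInstance
    have := congrFun hr ⟨M, Classical.arbitrary _⟩
    have hpos := uniformRule_pos (𝓜 := 𝓜 t) ⟨M, Classical.arbitrary _⟩
    rw [← this] at hpos
    simp [Matrix.mulVec, dotProduct] at hpos
  -- The other factors are inert: the tensor carries one fixed column there, and the witness carries
  -- the all-ones functional `o`, which is positive on every column.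
  let c₀ : ∀ t, {c // c ∈ 𝒞 t} := fun t => Classical.arbitrary _
  let e : ∀ t, {c // c ∈ 𝒞 t} → ℝ := fun t => Pi.single (c₀ t) 1
  have he : ∀ t, choiceMatrix (𝒞 t) *ᵥ e t = (choiceMatrix (𝒞 t)).col (c₀ t) :=
    fun t => Matrix.mulVec_single_one _ _
  let T := fun (y₁ : {c // c ∈ 𝒞 t₁} → ℝ) (y₂ : {c // c ∈ 𝒞 t₂} → ℝ) =>
    pureTensor (update₂ e t₁ y₁ t₂ y₂)
  have hT : ∀ (p : ∀ t, MenuChoice (𝓜 t) → ℝ) y₁ y₂,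
      pureTensor p ⬝ᵥ (kroneckerFamily (fun t => choiceMatrix (𝒞 t)) *ᵥ T y₁ y₂) =
        (∏ t ∈ (Finset.univ.erase t₁).erase t₂, p t ⬝ᵥ (choiceMatrix (𝒞 t) *ᵥ e t)) *
          (p t₁ ⬝ᵥ (choiceMatrix (𝒞 t₁) *ᵥ y₁) * p t₂ ⬝ᵥ (choiceMatrix (𝒞 t₂) *ᵥ y₂)) := by
    intro p y₁ y₂
    rw [kroneckerFamily_mulVec_pureTensor, pureTensor_dotProduct]
    exact prod_update₂_right (fun t x y => x ⬝ᵥ (choiceMatrix (𝒞 t) *ᵥ y)) hne p e y₁ y₂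
  let v := T u₁ w₂ + T u₂ w + T u w₁ - (1 / 4 : ℝ) • T u w
  have hv : ∀ p : (∀ t, MenuChoice (𝓜 t)) → ℝ,
      p ⬝ᵥ (kroneckerFamily (fun t => choiceMatrix (𝒞 t)) *ᵥ v) =
        p ⬝ᵥ (kroneckerFamily (fun t => choiceMatrix (𝒞 t)) *ᵥ T u₁ w₂) +
        p ⬝ᵥ (kroneckerFamily (fun t => choiceMatrix (𝒞 t)) *ᵥ T u₂ w) +
        p ⬝ᵥ (kroneckerFamily (fun t => choiceMatrix (𝒞 t)) *ᵥ T u w₁) -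
        1 / 4 * p ⬝ᵥ (kroneckerFamily (fun t => choiceMatrix (𝒞 t)) *ᵥ T u w) := by
    intro p
    simp only [v, Matrix.mulVec_sub, Matrix.mulVec_add, Matrix.mulVec_smul, dotProduct_sub,
      dotProduct_add, dotProduct_smul, smul_eq_mul]
  let o : ∀ t, MenuChoice (𝓜 t) → ℝ := fun t => 1
  have ho : ∀ t c, 0 < o t ⬝ᵥ (choiceMatrix (𝒞 t)).col c := by
    intro t c
    obtain ⟨M⟩ : Nonempty (Menu (𝓜 t)) := inferInstance
    refine Finset.sum_pos' (fun a _ => ?_) ⟨⟨M, c.1 M⟩, Finset.mem_univ _, ?_⟩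
    · exact mul_nonneg zero_le_one (choiceMatrix_nonneg _ a c)
    · simp [o, choiceMatrix]
  let F := fun y₁ y₂ => pureTensor (update₂ o t₁ y₁ t₂ y₂)
  -- The witness vanishes on the first three terms of `v` and is positive on `T u w`, so only the
  -- term with coefficient `-1/4` survives.
  refine ⟨v, fun p hp => ?_, F l₁ (k + k₁) + F l₂ k₂ + F l (k + k₂), fun c => ?_, ?_⟩
  · rw [hv, hT, hT, hT, hT]
    have hrest : 0 ≤ ∏ t ∈ (Finset.univ.erase t₁).erase t₂,
        p t ⬝ᵥ (choiceMatrix (𝒞 t) *ᵥ e t) :=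
      Finset.prod_nonneg fun t _ => by rw [he]; exact hp t (c₀ t)
    obtain ⟨p0, p1, p2, p3⟩ := hu (p t₁) (hp t₁)
    obtain ⟨q0, q1, q2, q3⟩ := hw (p t₂) (hp t₂)
    have := mul_nonneg hrest (kite_product_nonneg p0 p1 p2 q0 q1 q2 p3 q3)
    linarith
  · have hcol : (kroneckerFamily (fun t => choiceMatrix (𝒞 t))).col c =
        pureTensor fun t => (choiceMatrix (𝒞 t)).col (c t) := rfl
    have hF : ∀ y₁ y₂, F y₁ y₂ ⬝ᵥ pureTensor (fun t => (choiceMatrix (𝒞 t)).col (c t)) =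
        (∏ t ∈ (Finset.univ.erase t₁).erase t₂, o t ⬝ᵥ (choiceMatrix (𝒞 t)).col (c t)) *
          (y₁ ⬝ᵥ (choiceMatrix (𝒞 t₁)).col (c t₁) * y₂ ⬝ᵥ (choiceMatrix (𝒞 t₂)).col (c t₂)) := by
      intro y₁ y₂
      rw [pureTensor_dotProduct]
      exact prod_update₂_left (fun t x y => x ⬝ᵥ y) hne o y₁ y₂ _
    rw [hcol, add_dotProduct, add_dotProduct, hF, hF, hF, add_dotProduct, add_dotProduct]
    have hrest := Finset.prod_nonneg (s := (Finset.univ.erase t₁).erase t₂)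
      fun t _ => (ho t (c t)).le
    obtain ⟨a1, a2, a3, a4⟩ := hl (c t₁)
    obtain ⟨b1, b2, b3, b4⟩ := hk (c t₂)
    have := mul_nonneg hrest (kite_witness_nonneg a1 a2 a3 a4 b1 b2 b3 b4)
    linarith
  · have hFT : ∀ y₁ y₂ x₁ x₂,
        F y₁ y₂ ⬝ᵥ (kroneckerFamily (fun t => choiceMatrix (𝒞 t)) *ᵥ T x₁ x₂) =
        (∏ t ∈ (Finset.univ.erase t₁).erase t₂, o t ⬝ᵥ (choiceMatrix (𝒞 t) *ᵥ e t)) *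
          (y₁ ⬝ᵥ (choiceMatrix (𝒞 t₁) *ᵥ x₁) * y₂ ⬝ᵥ (choiceMatrix (𝒞 t₂) *ᵥ x₂)) := by
      intro y₁ y₂ x₁ x₂
      rw [kroneckerFamily_mulVec_pureTensor, pureTensor_dotProduct]
      exact prod_update₂ (fun t x y => x ⬝ᵥ (choiceMatrix (𝒞 t) *ᵥ y)) hne o y₁ y₂ e x₁ x₂
    have hrest : 0 < ∏ t ∈ (Finset.univ.erase t₁).erase t₂,
        o t ⬝ᵥ (choiceMatrix (𝒞 t) *ᵥ e t) :=
      Finset.prod_pos fun t _ => by rw [he]; exact ho t (c₀ t)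
    rw [hv]
    simp only [add_dotProduct, hFT, h0, h1, h2, g0, g1, g2]
    linarith

/-- The entangled tensor, scaled to total mass `1`, is a joint rule meeting all product restrictions
and marginality. A nonnegative representation would contradict the sign of the witness. -/
theorem subsingleton_of_onlySeparableRestrictions (hgen : ∀ t, IsGenerating (𝒞 t))
    (hH : ∀ t, IsHRepresentation (choiceMatrix (𝒞 t)) (H t))
    (h : OnlySeparableRestrictions 𝒞 H) :
    {t | ¬ HasUniqueRepresentation (𝒞 t)}.Subsingleton := by
  classical
  intro t₁ h₁ t₂ h₂
  by_contra hne
  obtain ⟨v, hv, W, hW, hWv⟩ := exists_entangled hgen hne h₁ h₂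
  set A := kroneckerFamily (fun t => choiceMatrix (𝒞 t)) with hA
  -- Coordinate functionals are products of rows of identity matrices, and these are nonnegative on
  -- the columns.
  have hpos : 0 ≤ A *ᵥ v := by
    have h0 : ∀ a, 0 ≤ (kroneckerFamily
        (fun t => (1 : Matrix (MenuChoice (𝓜 t)) (MenuChoice (𝓜 t)) ℝ)) *ᵥ (A *ᵥ v)) a :=
      fun a => hv (fun t => (1 : Matrix (MenuChoice (𝓜 t)) (MenuChoice (𝓜 t)) ℝ) (a t))
        fun t c => by
          have := congrFun (Matrix.one_mulVec ((choiceMatrix (𝒞 t)).col c)) (a t)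
          exact this.ge.trans' (choiceMatrix_nonneg _ (a t) c)
    rwa [kroneckerFamily_one, Matrix.one_mulVec] at h0
  -- Every menu path carries the total mass `∑ c, v c`. If it were zero, the nonnegative tensor
  -- would vanish, and the witness could not be negative on it.
  have hmass : 0 < ∑ c, v c := by
    refine lt_of_le_of_ne ?_ fun h0 => ?_
    · rw [← sum_kroneckerFamily_mulVec v fun t => Classical.arbitrary (Menu (𝓜 t))]
      exact Finset.sum_nonneg fun x _ => hpos _
    · have : A *ᵥ v = 0 := by
        funext a
        have hs := (sum_kroneckerFamily_mulVec v fun t => (a t).1).trans h0.symm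
        exact (Finset.sum_eq_zero_iff_of_nonneg fun (x : ∀ t, Alt (a t).1) _ =>
          hpos fun t => ⟨(a t).1, x t⟩).1 hs (fun t => (a t).2) (Finset.mem_univ _)
      rw [this, dotProduct_zero] at hWv
      exact lt_irrefl _ hWv
  set κ := ∑ c, v c with hκ
  have hrule : IsJointChoiceRule (A *ᵥ (κ⁻¹ • v)) := by
    refine ⟨fun a => ?_, fun M => ?_⟩
    · rw [Matrix.mulVec_smul]
      exact mul_nonneg (inv_pos.2 hmass).le (hpos a)
    · rw [hA, sum_kroneckerFamily_mulVec]
      simp only [Pi.smul_apply, smul_eq_mul, ← Finset.mul_sum]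
      rw [← hκ, inv_mul_cancel₀ hmass.ne']
  obtain ⟨ν, hν, heq⟩ := (h _ hrule).2 ⟨by
    rw [Matrix.mulVec_smul, Matrix.mulVec_smul]
    exact smul_nonneg (inv_pos.2 hmass).le (fun i => hv (fun t => H t (i t)) fun t c => (hH t).mul_nonneg (i t) c),
    marginality_kroneckerFamily_mulVec 𝒞 _⟩
  have h1 : W ⬝ᵥ (A *ᵥ (κ⁻¹ • v)) < 0 := by
    rw [Matrix.mulVec_smul, dotProduct_smul]
    exact mul_neg_of_pos_of_neg (inv_pos.2 hmass) hWv
  rw [heq, Matrix.dotProduct_mulVec] at h1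
  exact absurd (Finset.sum_nonneg fun c _ => mul_nonneg (hW c) (hν c)) (not_le.2 h1)

end Joint

end SeparableChoice

open SeparableChoice
open scoped Matrix
theorem theorem3 {ι : Type*} [Fintype ι] [DecidableEq ι] {X : ι → Type*}
    (𝓜 : ∀ t, MenuFamily (X t))
    (𝒞 : ∀ t, Finset (ChoiceFun (𝓜 t)))
    (hgen : ∀ t, IsGenerating (𝒞 t))
    {R : ι → Type*} [∀ t, Finite (R t)]
    (H : ∀ t, Matrix (R t) (MenuChoice (𝓜 t)) ℝ)
    (hH : ∀ t, IsHRepresentation (choiceMatrix (𝒞 t)) (H t)) :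
    (OnlySeparableRestrictions 𝒞 H ↔ {t | ¬ HasUniqueRepresentation (𝒞 t)}.Subsingleton) ∧
      ∀ ρ : (∀ t, MenuChoice (𝓜 t)) → ℝ,
        Marginality ρ ↔ ∃ v, ρ = kroneckerFamily (fun t => choiceMatrix (𝒞 t)) *ᵥ v := by
  refine ⟨⟨subsingleton_of_onlySeparableRestrictions hgen hH,
    onlySeparableRestrictions_of_subsingleton hgen hH⟩, fun ρ =>
    ⟨exists_eq_kroneckerFamily_mulVec_of_marginality hgen, ?_⟩⟩
  rintro ⟨v, rfl⟩
  exact marginality_kroneckerFamily_mulVec 𝒞 v
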